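/- Consider a 2-barrier system with $s\ge 1$ workers and jobs of $k$ tasks each, where $k$ divides $s$, all workers being idle at time $0$. Jobs arrive at the points of a Poisson process of rate $\lambda>0$ and wait in a first-come-first-served queue. When the job at the front of the queue finds at least $k$ idle workers, its $k$ tasks start simultaneously on $k$ idle workers (start barrier), and these $k$ workers are all released only when the last of the $k$ tasks has finished; this is when the job departs (departure barrier). The task times are iid exponential with rate $\mu>0$, independent of the arrivals. Write $H_k=\sum_{j=1}^k 1/j$, let $\varrho=k\lambda/(s\mu)$ be the utilization, and let $A(n)$ and $D(n)$ be the arrival and departure times of the $n$-th job. Then: (i) Almost surely, all start and departure times of jobs coincide with those of the first-come-first-served M$|$G$|m$ queue with $m=s/k$ servers, the same arrivals, and service times the maxima of the $k$ task times of each job. These maxima are iid and independent of the arrivals. (ii) The service time $X_{(k)}$ (the maximum of $k$ iid exponential random variables with rate $\mu$) has the law of $\sum_{j=1}^k Y_j$ with independent $Y_j\sim\mathrm{Exp}(j\mu)$ (Rényi's formula); it is integrable and $\mathsf E[X_{(k)}]=H_k/\mu$. (iii) The system is stable if and only if $$\lambda<\frac{s}{k}\,\frac{\mu}{H_k},\qquad\text{equivalently,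 if and only if}\qquad \varrho<\frac1{H_k}=\frac{1}{\sum_{j=0}^{k-1}\frac1{k-j}},$$ a bound that does not depend on $s$. Here stable means that the delay $D(n)-A(n)$ of the $n$-th job converges in distribution, as $n\to\infty$, to a finite random variable. The same equivalences hold if stable means that the backlog found by the $n$-th job (the number of earlier jobs that have not departed by time $A(n)$) converges in distribution, as $n\to\infty$, to a finite random variable. -/

import Mathlib

open MeasureTheory ProbabilityTheory Filter

noncomputable section

namespace BEM

/-! ### The worker-level 2-barrier system

`f w` is the time at which worker `w` becomes available. -/

/-- The workers that are idle at time `t`. -/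
def idle {s : ℕ} (f : Fin s → ℝ) (t : ℝ) : Finset (Fin s) :=
  Finset.univ.filter fun w => f w ≤ t

/-- Start barrier: a job with `k` tasks that has arrived at time `a` and is at the front of the
queue starts all its tasks at the first time from `a` on at which at least `k` workers are idle. -/
def jobStart {s : ℕ} (k : ℕ) (f : Fin s → ℝ) (a : ℝ) : ℝ :=
  sInf {t : ℝ | a ≤ t ∧ k ≤ (idle f t).card}

/-- The `k` idle workers with the smallest labels at time `t`; they receive the tasks. -/
def selected {s : ℕ} (k : ℕ) (f : Fin s → ℝ) (t : ℝ) : Finset (Fin s) :=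
  (idle f t).filter fun w => ((idle f t).filter fun w' => w' < w).card < k

/-- A job that starts its tasks at time `b` departs when the last of its tasks, with task
times `x i`, finishes. -/
def jobDeparture {k : ℕ} (b : ℝ) (x : Fin k → ℝ) : ℝ := ⨆ i, (b + x i)

/-- Departure barrier: if a job arriving at `a` with task times `x` is served, its `k`
workers are all blocked until the job departs. -/
def nextFree {s k : ℕ} (f : Fin s → ℝ) (a : ℝ) (x : Fin k → ℝ) : Fin s → ℝ := fun w =>
  if w ∈ selected k f (jobStart k f a) then jobDeparture (jobStart k f a) x else f w

/-- Times at which the `s` workers become available, as seen after jobs `0, …, n - 1` have been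
assigned (in order of arrival); job `n` arrives at `a n` and has task times `x n`.
All workers are idle initially. -/
def freeTimes (s : ℕ) {k : ℕ} (a : ℕ → ℝ) (x : ℕ → Fin k → ℝ) : ℕ → Fin s → ℝ
  | 0 => fun _ => 0
  | n + 1 => nextFree (freeTimes s a x n) (a n) (x n)

/-- Common start time of the tasks of job `n` in the 2-barrier system with `s` workers. -/
def start (s : ℕ) {k : ℕ} (a : ℕ → ℝ) (x : ℕ → Fin k → ℝ) (n : ℕ) : ℝ :=
  jobStart k (freeTimes s a x n) (a n)

/-- Departure time of job `n` in the 2-barrier system with `s` workers. -/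
def departure (s : ℕ) {k : ℕ} (a : ℕ → ℝ) (x : ℕ → Fin k → ℝ) (n : ℕ) : ℝ :=
  jobDeparture (start s a x n) (x n)

/-! ### The ordinary first-come-first-served queue with `m` servers -/

/-- A job that has arrived at time `a` and is at the front of the queue starts service at the
first time from `a` on at which some server is idle. -/
def serviceStart {m : ℕ} (u : Fin m → ℝ) (a : ℝ) : ℝ :=
  sInf {t : ℝ | a ≤ t ∧ ∃ j, u j ≤ t}

/-- Times at which the `m` servers become available, as seen after jobs `0, …, n - 1` have been
assigned; job `n` arrives at `a n` and has service time `g n`, and it is served by the idle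
server with the smallest label. -/
def serverFree (m : ℕ) (a g : ℕ → ℝ) : ℕ → Fin m → ℝ
  | 0 => fun _ => 0
  | n + 1 => fun j =>
      let u := serverFree m a g n
      let b := serviceStart u (a n)
      if u j ≤ b ∧ ∀ i < j, b < u i then b + g n else u j

/-- Service start time of job `n` in the `m`-server queue. -/
def queueStart (m : ℕ) (a g : ℕ → ℝ) (n : ℕ) : ℝ := serviceStart (serverFree m a g n) (a n)

/-- Departure time of job `n` in the `m`-server queue. -/
def queueDeparture (m : ℕ) (a g : ℕ → ℝ) (n : ℕ) : ℝ := queueStart m a g n + g n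

/-! ### Stochastic inputs -/

variable {Ω : Type*} [MeasurableSpace Ω]

/-- Arrival time of job `n`: the sum of the inter-arrival times `T 0, …, T n`. -/
def arrival (T : ℕ → Ω → ℝ) (ω : Ω) (n : ℕ) : ℝ := ∑ i ∈ Finset.range (n + 1), T i ω

/-- Poisson arrivals of rate `lam` (inter-arrival times iid exponential), and task times
`X n i` (task `i` of job `n`) iid exponential with rate `μ`, independent of the arrivals. -/
structure IsExpInput (lam μ : ℝ) {k : ℕ} (T : ℕ → Ω → ℝ) (X : ℕ → Fin k → Ω → ℝ)
    (P : Measure Ω) : Prop where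
  interarrival_law : ∀ n, HasLaw (T n) (expMeasure lam) P
  task_law : ∀ n i, HasLaw (X n i) (expMeasure μ) P
  indep : iIndepFun (Sum.elim T fun p : ℕ × Fin k => X p.1 p.2) P

/-- The start times `B` and departure times `D` are those of the M|G|m queue with arrival
rate `lam`, service time distribution `ν`, inter-arrival times `T` and service times `G`. -/
structure IsMGQueue (lam : ℝ) (ν : Measure ℝ) (m : ℕ) (T G B D : ℕ → Ω → ℝ)
    (P : Measure Ω) : Prop where
  interarrival_law : ∀ n, HasLaw (T n) (expMeasure lam) P
  service_law : ∀ n, HasLaw (G n) ν P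
  indep : iIndepFun (Sum.elim T G) P
  start_eq : ∀ᵐ ω ∂P, ∀ n, B n ω = queueStart m (arrival T ω) (fun j => G j ω) n
  departure_eq : ∀ᵐ ω ∂P, ∀ n, D n ω = queueDeparture m (arrival T ω) (fun j => G j ω) n

/-- The law of the maximum of `k` iid exponential random variables with rate `μ`. -/
def maxExpLaw (k : ℕ) (μ : ℝ) : Measure ℝ :=
  (Measure.pi fun _ : Fin k => expMeasure μ).map fun x => ⨆ i, x i

/-- Job start times of the 2-barrier system. -/
def startTime (s : ℕ) {k : ℕ} (T : ℕ → Ω → ℝ) (X : ℕ → Fin k → Ω → ℝ) (n : ℕ) (ω : Ω) : ℝ :=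
  start s (arrival T ω) (fun j i => X j i ω) n

/-- Job departure times of the 2-barrier system. -/
def departureTime (s : ℕ) {k : ℕ} (T : ℕ → Ω → ℝ) (X : ℕ → Fin k → Ω → ℝ) (n : ℕ) (ω : Ω) : ℝ :=
  departure s (arrival T ω) (fun j i => X j i ω) n

/-! ### Stability -/

/-- Convergence in distribution to some (finite) random variable. -/
def ConvergesInDistribution {E : Type*} [TopologicalSpace E] [MeasurableSpace E]
    [OpensMeasurableSpace E] (Y : ℕ → Ω → E) (P : Measure Ω) [IsProbabilityMeasure P] : Prop :=
  ∃ ν : ProbabilityMeasure E, TendstoInDistribution Y atTop id (fun _ => P) (ν : Measure E)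

/-- Delay (sojourn time) of job `n` in the 2-barrier system. -/
def delay (s : ℕ) {k : ℕ} (T : ℕ → Ω → ℝ) (X : ℕ → Fin k → Ω → ℝ) (n : ℕ) (ω : Ω) : ℝ :=
  departureTime s T X n ω - arrival T ω n

/-- Backlog of the 2-barrier system at the arrival of job `n`: the number of earlier jobs that
have not yet departed. -/
def backlog (s : ℕ) {k : ℕ} (T : ℕ → Ω → ℝ) (X : ℕ → Fin k → Ω → ℝ) (n : ℕ) (ω : Ω) : ℕ :=
  ((Finset.range n).filter fun j => arrival T ω n < departureTime s T X j ω).card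

/-- The system is stable: the delay converges in distribution. -/
def DelayStable (s : ℕ) {k : ℕ} (T : ℕ → Ω → ℝ) (X : ℕ → Fin k → Ω → ℝ) (P : Measure Ω)
    [IsProbabilityMeasure P] : Prop :=
  ConvergesInDistribution (delay s T X) P

/-- The system is stable: the backlog converges in distribution. -/
def BacklogStable (s : ℕ) {k : ℕ} (T : ℕ → Ω → ℝ) (X : ℕ → Fin k → Ω → ℝ) (P : Measure Ω)
    [IsProbabilityMeasure P] : Prop :=
  ConvergesInDistribution (backlog s T X) P

/-- Utilization of a system with `s` workers, `k` tasks per job, job arrival rate `lam` and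
task service rate `μ`. -/
def utilization (s k : ℕ) (lam μ : ℝ) : ℝ := (k : ℝ) * lam / ((s : ℝ) * μ)

end BEM

end

/-!
The departure barrier releases `k` workers at once and the start barrier takes `k` at once, so the
workers always behave like `m = s / k` groups, even though the groups are formed anew for each
job: from the last arrival on, the number of idle workers is `k` times the number of idle servers
of the queue (`BEM.card_idle_freeTimes`). This gives the identity with the M|G|m queue whose
service time is the maximum of the task times. Rényi's formula for that maximum is proved on
distribution functions, by induction on `k` (`BEM.measureReal_sumExpLaw_Iic`).

For stability, the queue is described by the vector of remaining loads of its servers seen by the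
arriving jobs, where each job joins the least loaded server (`BEM.workload`). All that is used of
the service times is that they are nonnegative, iid with a finite second moment, and independent
of the arrivals (`BEM.QueueInput`).

*Below the critical load.* The recursion is monotone up to relabelling of the servers, so reversing
the order of the iid inputs turns delay and backlog into pathwise nondecreasing sequences with
unchanged one-dimensional laws (Loynes' scheme); it remains to bound them in probability
(`BEM.convergesInDistribution_of_monotone`). The least load is at most the average load, so the
sum of the squared loads has mean drift at most `-δ q + c`, where `q` is the mean total load and
`δ > 0` exactly when the mean service time is below `m / lam`. As `q` is nondecreasing along the
jobs and the sum of squares is nonnegative, `δ q ≤ c` (`BEM.QueueInput.mul_le_of_drift`). This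
bounds the delay; a Chernoff bound on the arrivals then bounds the backlog.

*At and above the critical load.* The total load is at least a random walk with iid increments of
nonnegative mean and positive variance, so by the central limit theorem it exceeds `√n` with
probability bounded away from zero, while the largest of the first `n` service times is `o(√n)` in
probability. The loads of two servers differ by at most the largest service time
(`BEM.workload_le_add`), and the total load is at most the backlog times the largest service time
(`BEM.sum_workload_le_queueBacklog`). Hence neither delay nor backlog is bounded in probability.
-/

namespace BEM

open scoped ENNReal Topology

/-! ### Workload vectors of the queue -/

/-- `j` is the smallest label among the least loaded servers. This is the server that takes the
next job, since the servers idle at the start of service are those of least remaining load. -/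
def IsServed {m : ℕ} (w : Fin m → ℝ) (j : Fin m) : Prop :=
  w j ≤ ⨅ i, w i ∧ ∀ i < j, ⨅ l, w l < w i

open Classical in
/-- One step of the Kiefer–Wolfowitz recursion, for labelled servers: a job with service
time `g` joins the least loaded server, then a time `t` passes. -/
noncomputable def workloadStep {m : ℕ} (w : Fin m → ℝ) (t g : ℝ) : Fin m → ℝ := fun j =>
  max 0 ((if IsServed w j then w j + g else w j) - t)

/-- The remaining loads of the `m` servers seen by job `n` on its arrival, where `t n` is the time
between the arrivals of jobs `n - 1` and `n` and `g n` is the service time of job `n`. -/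
noncomputable def workload (m : ℕ) (t g : ℕ → ℝ) : ℕ → Fin m → ℝ
  | 0 => 0
  | n + 1 => workloadStep (workload m t g n) (t (n + 1)) (g n)

/-- Waiting time of job `n`: the load of the least loaded server. -/
noncomputable def waiting (m : ℕ) (t g : ℕ → ℝ) (n : ℕ) : ℝ := ⨅ j, workload m t g n j

open Classical in
/-- The number of jobs before job `n` that depart more than a time `y` after the arrival of
job `n`; for `y = 0` this is the backlog. -/
noncomputable def queueBacklog (m : ℕ) (t g : ℕ → ℝ) (n : ℕ) (y : ℝ) : ℕ :=
  ((Finset.range n).filter fun j =>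
    ∑ i ∈ Finset.Ioc j n, t i + y < waiting m t g j + g j).card

section Deterministic

variable {m : ℕ}

lemma exists_least_label {u : Fin m → ℝ} {c : ℝ} (h : ∃ j, u j ≤ c) :
    ∃ j, u j ≤ c ∧ ∀ i < j, c < u i := by
  classical
  have hne : (Finset.univ.filter fun j => u j ≤ c).Nonempty := by
    obtain ⟨j, hj⟩ := h
    exact ⟨j, by simpa using hj⟩
  refine ⟨_, (Finset.mem_filter.1 (Finset.min'_mem _ hne)).2, fun i hi => ?_⟩
  by_contra! hc
  exact absurd (Finset.min'_le _ i (by simpa using hc)) (not_le.2 hi)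

lemma least_label_unique {u : Fin m → ℝ} {c : ℝ} {i j : Fin m}
    (hi : u i ≤ c ∧ ∀ l < i, c < u l) (hj : u j ≤ c ∧ ∀ l < j, c < u l) : i = j := by
  rcases lt_trichotomy i j with h | h | h
  · exact absurd hi.1 (not_le.2 (hj.2 i h))
  · exact h
  · exact absurd hj.1 (not_le.2 (hi.2 j h))

lemma iInf_fin_le (w : Fin m → ℝ) (j : Fin m) : ⨅ i, w i ≤ w j :=
  ciInf_le (Set.finite_range w).bddBelow j

lemma IsServed.eq_iInf {w : Fin m → ℝ} {j : Fin m} (h : IsServed w j) : w j = ⨅ i, w i :=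
  le_antisymm h.1 (iInf_fin_le w j)

lemma exists_isServed [NeZero m] (w : Fin m → ℝ) :
    ∃ j, IsServed w j ∧ ∀ i, IsServed w i ↔ i = j := by
  obtain ⟨i, hi⟩ := exists_eq_ciInf_of_finite (f := w)
  obtain ⟨j, hj⟩ := exists_least_label (u := w) (c := ⨅ i, w i) ⟨i, hi.le⟩
  exact ⟨j, hj, fun l => ⟨fun hl => least_label_unique hl hj, fun hl => hl ▸ hj⟩⟩

lemma exists_workloadStep_eq [NeZero m] (w : Fin m → ℝ) :
    ∃ j₀, w j₀ = ⨅ i, w i ∧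
      ∀ t g, workloadStep w t g = fun j => max 0 (w j + (if j = j₀ then g else 0) - t) := by
  obtain ⟨j₀, h, hiff⟩ := exists_isServed w
  refine ⟨j₀, h.eq_iInf, fun t g => ?_⟩
  ext j
  simp only [workloadStep, hiff]
  split_ifs <;> simp

lemma workload_nonneg (t g : ℕ → ℝ) (n : ℕ) (j : Fin m) : 0 ≤ workload m t g n j := by
  cases n with
  | zero => simp [workload]
  | succ n => simp [workload, workloadStep]

lemma waiting_nonneg (t g : ℕ → ℝ) (n : ℕ) : 0 ≤ waiting m t g n :=
  Real.iInf_nonneg fun j => workload_nonneg t g n j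

lemma waiting_le (t g : ℕ → ℝ) (n : ℕ) (j : Fin m) : waiting m t g n ≤ workload m t g n j :=
  iInf_fin_le _ j

/-! ### The queue in terms of its workload vectors -/

lemma serviceStart_eq [NeZero m] (u : Fin m → ℝ) (a : ℝ) :
    serviceStart u a = a + ⨅ j, max 0 (u j - a) := by
  obtain ⟨j₀, hj₀⟩ := exists_eq_ciInf_of_finite (f := fun j => max 0 (u j - a))
  refine IsLeast.csInf_eq ⟨⟨?_, j₀, ?_⟩, ?_⟩
  · rw [← hj₀]; linarith [le_max_left 0 (u j₀ - a)]
  · rw [← hj₀]; linarith [le_max_right 0 (u j₀ - a)]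
  · rintro t ⟨h1, j, hj⟩
    have := iInf_fin_le (fun j => max 0 (u j - a)) j
    have h2 : max 0 (u j - a) ≤ t - a := max_le (by linarith) (by linarith)
    linarith

lemma serverFree_succ (a g : ℕ → ℝ) (n : ℕ) (j : Fin m) :
    serverFree m a g (n + 1) j =
      if serverFree m a g n j ≤ serviceStart (serverFree m a g n) (a n) ∧
        ∀ i < j, serviceStart (serverFree m a g n) (a n) < serverFree m a g n i
      then serviceStart (serverFree m a g n) (a n) + g n else serverFree m a g n j := rfl

lemma sum_range_add_sum_Ioc (t : ℕ → ℝ) {j n : ℕ} (h : j ≤ n) :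
    ∑ i ∈ Finset.range (j + 1), t i + ∑ i ∈ Finset.Ioc j n, t i =
      ∑ i ∈ Finset.range (n + 1), t i := by
  induction n, h using Nat.le_induction with
  | base => simp
  | succ n h ih =>
    rw [Finset.sum_Ioc_succ_top h, ← add_assoc, ih, Finset.sum_range_succ _ (n + 1)]

lemma workload_eq [NeZero m] {t g : ℕ → ℝ} (ht : ∀ n, 0 ≤ t n) (n : ℕ) (j : Fin m) :
    workload m t g n j =
      max 0 (serverFree m (fun n => ∑ i ∈ Finset.range (n + 1), t i) g n j
        - ∑ i ∈ Finset.range (n + 1), t i) := by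
  induction n generalizing j with
  | zero => simp [workload, serverFree, ht 0]
  | succ n ih =>
    set a : ℕ → ℝ := fun n => ∑ i ∈ Finset.range (n + 1), t i with ha
    have hw : workload m t g n = fun j => max 0 (serverFree m a g n j - a n) := funext ih
    have hb : serviceStart (serverFree m a g n) (a n) = a n + ⨅ j, workload m t g n j := by
      rw [serviceStart_eq, hw]
    have hW : 0 ≤ ⨅ j, workload m t g n j := waiting_nonneg t g n
    have hiff : ∀ i, serverFree m a g n i ≤ a n + ⨅ j, workload m t g n j ↔
        workload m t g n i ≤ ⨅ j, workload m t g n j := by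
      intro i
      rw [ih i, max_le_iff]
      exact ⟨fun h => ⟨hW, by linarith⟩, fun h => by linarith [h.2]⟩
    have hserved : (serverFree m a g n j ≤ a n + ⨅ j, workload m t g n j ∧
        ∀ i < j, a n + ⨅ j, workload m t g n j < serverFree m a g n i) ↔
        IsServed (workload m t g n) j := by
      simp only [IsServed, ← not_le, hiff]
    have hstep : a (n + 1) = a n + t (n + 1) := Finset.sum_range_succ _ _
    have ht' := ht (n + 1)
    change workloadStep (workload m t g n) (t (n + 1)) (g n) j =
      max 0 (serverFree m a g (n + 1) j - a (n + 1))
    rw [serverFree_succ, hb]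
    by_cases h : IsServed (workload m t g n) j
    · rw [if_pos (hserved.2 h), workloadStep, if_pos h, h.eq_iInf, hstep]; congr 1; ring
    · rw [if_neg (mt hserved.1 h), workloadStep, if_neg h, ih j, hstep]
      rcases le_total 0 (serverFree m a g n j - a n) with h1 | h1
      · rw [max_eq_right h1]; congr 1; ring
      · rw [max_eq_left h1, max_eq_left (by linarith), max_eq_left]; linarith

lemma queueStart_eq [NeZero m] {t g : ℕ → ℝ} (ht : ∀ n, 0 ≤ t n) (n : ℕ) :
    queueStart m (fun n => ∑ i ∈ Finset.range (n + 1), t i) g n =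
      ∑ i ∈ Finset.range (n + 1), t i + waiting m t g n := by
  rw [queueStart, serviceStart_eq, waiting]
  simp_rw [workload_eq ht]

lemma card_not_departed_eq_queueBacklog [NeZero m] {t g : ℕ → ℝ} (ht : ∀ n, 0 ≤ t n) (n : ℕ) :
    ((Finset.range n).filter fun j => ∑ i ∈ Finset.range (n + 1), t i <
      queueDeparture m (fun n => ∑ i ∈ Finset.range (n + 1), t i) g j).card =
      queueBacklog m t g n 0 := by
  classical
  unfold queueBacklog
  congr 1
  ext j
  simp only [Finset.mem_filter, Finset.mem_range, queueDeparture, queueStart_eq ht]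
  refine and_congr_right fun hj => ?_
  rw [← sum_range_add_sum_Ioc t hj.le]
  constructor <;> intro h <;> linarith

/-! ### Monotonicity of the workload -/

/-- Domination of load vectors up to relabelling of the servers. -/
def LoadLE (w w' : Fin m → ℝ) : Prop := ∃ σ : Equiv.Perm (Fin m), ∀ j, w j ≤ w' (σ j)

lemma LoadLE.iInf_le [NeZero m] {w w' : Fin m → ℝ} (h : LoadLE w w') : ⨅ j, w j ≤ ⨅ j, w' j := by
  obtain ⟨σ, hσ⟩ := h
  refine le_ciInf fun j => (iInf_fin_le w (σ.symm j)).trans ?_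
  simpa using hσ (σ.symm j)

lemma LoadLE.sum_le {w w' : Fin m → ℝ} (h : LoadLE w w') : ∑ j, w j ≤ ∑ j, w' j := by
  obtain ⟨σ, hσ⟩ := h
  exact (Finset.sum_le_sum fun j _ => hσ j).trans (Equiv.sum_comp σ w').le

/-- Joining the least loaded server preserves domination: after composing the relabelling with a
transposition, it matches the two servers that take the job. -/
lemma LoadLE.step [NeZero m] {w w' : Fin m → ℝ} (h : LoadLE w w') (t g : ℝ) :
    LoadLE (workloadStep w t g) (workloadStep w' t g) := by
  obtain ⟨σ, hσ⟩ := h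
  obtain ⟨j₀, h₀, e₀⟩ := exists_workloadStep_eq w
  obtain ⟨j₁, h₁, e₁⟩ := exists_workloadStep_eq w'
  rw [e₀, e₁]
  refine ⟨σ.trans (Equiv.swap (σ j₀) j₁), fun j => ?_⟩
  refine max_le_max le_rfl (sub_le_sub_right ?_ t)
  have hmin : w j₀ ≤ w' j₁ := by
    rw [h₀, h₁]; exact LoadLE.iInf_le ⟨σ, hσ⟩
  by_cases hj : j = j₀
  · subst hj; simpa using hmin
  · have hne : σ j ≠ σ j₀ := fun h => hj (σ.injective h)
    have hne1 : Equiv.swap (σ j₀) j₁ (σ j) ≠ j₁ := by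
      intro h
      apply hne
      have := congrArg (Equiv.swap (σ j₀) j₁) h
      simpa using this
    have hne2 : (σ.trans (Equiv.swap (σ j₀) j₁)) j ≠ j₁ := hne1
    rw [if_neg hj, if_neg hne2, add_zero, add_zero, Equiv.trans_apply]
    by_cases hj1 : σ j = j₁
    · rw [hj1, Equiv.swap_apply_right]
      have h2 := hσ j
      have h3 := iInf_fin_le w' (σ j₀)
      rw [hj1] at h2
      linarith
    · rw [Equiv.swap_apply_of_ne_of_ne hne hj1]
      exact hσ j

/-- Prepending a job increases the workload seen afterwards. -/
lemma loadLE_workload_succ [NeZero m] {t g t' g' : ℕ → ℝ} (n : ℕ)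
    (ht : ∀ i, 1 ≤ i → i ≤ n → t' (i + 1) = t i) (hg : ∀ i < n, g' (i + 1) = g i) :
    LoadLE (workload m t g n) (workload m t' g' (n + 1)) := by
  induction n with
  | zero => exact ⟨Equiv.refl _, fun j => by simpa [workload] using workload_nonneg t' g' 1 j⟩
  | succ n ih =>
    have := (ih (fun i h1 h2 => ht i h1 (by omega)) (fun i hi => hg i (by omega))).step
      (t (n + 1)) (g n)
    have e : workload m t' g' (n + 1 + 1) =
        workloadStep (workload m t' g' (n + 1)) (t (n + 1)) (g n) := by
      rw [workload, ht (n + 1) (by omega) le_rfl, hg n (by omega)]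
    rw [e]
    exact this

lemma queueBacklog_le_succ [NeZero m] {t g t' g' : ℕ → ℝ} (n : ℕ) (y : ℝ)
    (ht : ∀ i, 1 ≤ i → i ≤ n → t' (i + 1) = t i) (hg : ∀ i < n, g' (i + 1) = g i) :
    queueBacklog m t g n y ≤ queueBacklog m t' g' (n + 1) y := by
  classical
  refine Finset.card_le_card_of_injOn (· + 1) ?_ (add_left_injective 1).injOn
  intro j hj
  simp only [Finset.coe_filter, Finset.mem_range, Set.mem_ofPred_eq] at hj ⊢
  refine ⟨by omega, ?_⟩
  have h1 : ∑ i ∈ Finset.Ioc (j + 1) (n + 1), t' i = ∑ i ∈ Finset.Ioc j n, t i := by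
    refine Finset.sum_nbij' (· - 1) (· + 1) (fun i hi => ?_) (fun i hi => ?_) (fun i hi => ?_)
      (fun i hi => ?_) (fun i hi => ?_) <;> rw [Finset.mem_Ioc] at hi
    · exact Finset.mem_Ioc.2 (by omega)
    · exact Finset.mem_Ioc.2 (by omega)
    · omega
    · omega
    · rw [← ht (i - 1) (by omega) (by omega), Nat.sub_add_cancel (by omega)]
  have h2 : waiting m t g j ≤ waiting m t' g' (j + 1) :=
    (loadLE_workload_succ j (fun i hi hi' => ht i hi (by omega))
      (fun i hi => hg i (by omega))).iInf_le
  rw [h1, hg j hj.1]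
  linarith [hj.2]

/-! ### Pathwise bounds on the workload -/

lemma workload_le_sum [NeZero m] {t g : ℕ → ℝ} (ht : ∀ n, 0 ≤ t n) (hg : ∀ n, 0 ≤ g n)
    (n : ℕ) (j : Fin m) : workload m t g n j ≤ ∑ i ∈ Finset.range n, g i := by
  induction n generalizing j with
  | zero => simp [workload]
  | succ n ih =>
    obtain ⟨j₀, -, e⟩ := exists_workloadStep_eq (workload m t g n)
    rw [workload, e, Finset.sum_range_succ]
    refine max_le (add_nonneg (Finset.sum_nonneg fun i _ => hg i) (hg n)) ?_
    have := ih j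
    have := ht (n + 1)
    have := hg n
    split_ifs <;> linarith

/-- Total work grows at least by the new service time minus the full capacity of all servers. -/
lemma le_sum_workload [NeZero m] (t g : ℕ → ℝ) (n : ℕ) :
    ∑ i ∈ Finset.range n, (g i - m * t (i + 1)) ≤ ∑ j, workload m t g n j := by
  induction n with
  | zero => simp [workload]
  | succ n ih =>
    obtain ⟨j₀, -, e⟩ := exists_workloadStep_eq (workload m t g n)
    rw [workload, e, Finset.sum_range_succ]
    calc _ ≤ ∑ j, workload m t g n j + (g n - m * t (n + 1)) := by gcongr
      _ = ∑ j, (workload m t g n j + (if j = j₀ then g n else 0) - t (n + 1)) := by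
        simp [Finset.sum_add_distrib, Finset.sum_sub_distrib]; ring
      _ ≤ _ := Finset.sum_le_sum fun j _ => le_max_right _ _

/-- The loads of two servers never differ by more than the largest service time so far, because
each job joins the least loaded server. -/
lemma workload_le_add [NeZero m] {t g : ℕ → ℝ} {C : ℝ} (hC : 0 ≤ C) (hg0 : ∀ n, 0 ≤ g n)
    (n : ℕ) (hg : ∀ i < n, g i ≤ C) (j l : Fin m) :
    workload m t g n j ≤ workload m t g n l + C := by
  induction n generalizing j l with
  | zero => simpa [workload] using hC
  | succ n ih =>
    have ih := ih (fun i hi => hg i (by omega))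
    obtain ⟨j₀, h₀, e⟩ := exists_workloadStep_eq (workload m t g n)
    rw [workload, e]
    have key : workload m t g n j + (if j = j₀ then g n else 0) ≤
        workload m t g n l + (if l = j₀ then g n else 0) + C := by
      have h1 : 0 ≤ (if l = j₀ then g n else 0) := by split_ifs <;> simp [hg0]
      have h2 := ih j l
      have h3 := hg n (by omega)
      split_ifs at h1 ⊢ with hj hl hl
      · linarith
      · have := iInf_fin_le (workload m t g n) l
        rw [hj, h₀]; linarith
      · linarith
      · linarith
    refine max_le (add_nonneg (le_max_left _ _) hC) ?_
    linarith [le_max_right 0 (workload m t g n l + (if l = j₀ then g n else 0) - t (n + 1))]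

lemma queueBacklog_succ [NeZero m] (t g : ℕ → ℝ) (n : ℕ) (y : ℝ) :
    queueBacklog m t g (n + 1) y = queueBacklog m t g n (t (n + 1) + y) +
      if t (n + 1) + y < waiting m t g n + g n then 1 else 0 := by
  classical
  simp only [queueBacklog, Finset.card_filter, Finset.sum_range_succ]
  congr 1
  · refine Finset.sum_congr rfl fun j hj => ?_
    rw [Finset.mem_range] at hj
    rw [Finset.sum_Ioc_succ_top hj.le, add_assoc]
  · simp

/-- The work present is carried by the jobs that have not departed. -/
lemma sum_workload_le [NeZero m] {t g : ℕ → ℝ} {C : ℝ} (ht : ∀ n, 0 ≤ t n) (hg0 : ∀ n, 0 ≤ g n)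
    (n : ℕ) (hg : ∀ i < n, g i ≤ C) {y : ℝ} (hy : 0 ≤ y) :
    ∑ j, max 0 (workload m t g n j - y) ≤ queueBacklog m t g n y * C := by
  classical
  induction n generalizing y with
  | zero => simp [workload, queueBacklog, hy]
  | succ n ih =>
    obtain ⟨j₀, h₀, e⟩ := exists_workloadStep_eq (workload m t g n)
    have hty : 0 ≤ t (n + 1) + y := add_nonneg (ht _) hy
    have hgn := hg n (by omega)
    have hg0n := hg0 n
    have ih := ih (fun i hi => hg i (by omega)) hty
    rw [queueBacklog_succ, workload, e]
    push_cast
    rw [add_mul]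
    set z := t (n + 1) + y with hz
    calc ∑ j, max 0 (max 0 (workload m t g n j + (if j = j₀ then g n else 0) - t (n + 1)) - y)
        ≤ ∑ j, (max 0 (workload m t g n j - z) + if j = j₀ then
            (if z < waiting m t g n + g n then C else 0) else 0) := by
          refine Finset.sum_le_sum fun j _ => ?_
          have h1 := le_max_left 0 (workload m t g n j - z)
          have h2 := le_max_right 0 (workload m t g n j - z)
          have hC : 0 ≤ C := hg0n.trans hgn
          have hW : waiting m t g n = workload m t g n j₀ := h₀.symm
          have h3 : 0 ≤ (if j = j₀ then
            (if z < waiting m t g n + g n then C else 0) else 0) := by split_ifs <;> simp [hC]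
          refine max_le (by linarith) (sub_le_iff_le_add.2 (max_le (by linarith) ?_))
          split_ifs at h3 ⊢ with hj hlt
          · linarith
          · rw [hj] at h1 ⊢; linarith
          · linarith
      _ ≤ _ := by
          rw [Finset.sum_add_distrib]
          simp only [Finset.sum_ite_eq', Finset.mem_univ, if_true]
          split_ifs <;> simp <;> linarith

lemma sum_workload_le_queueBacklog [NeZero m] {t g : ℕ → ℝ} {C : ℝ} (ht : ∀ n, 0 ≤ t n)
    (hg0 : ∀ n, 0 ≤ g n) (n : ℕ) (hg : ∀ i < n, g i ≤ C) :
    ∑ j, workload m t g n j ≤ queueBacklog m t g n 0 * C := by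
  have := sum_workload_le ht hg0 n hg le_rfl (m := m)
  simpa [workload_nonneg] using this

/-- One-step drift of the sum of squared loads. The job joins the least loaded server, whose
load is at most the average load. -/
lemma sum_sq_workload_succ_le [NeZero m] {t g : ℕ → ℝ} (ht : ∀ n, 0 ≤ t n) (hg : ∀ n, 0 ≤ g n)
    (n : ℕ) :
    ∑ j, workload m t g (n + 1) j ^ 2 ≤ ∑ j, workload m t g n j ^ 2
      + 2 * ((∑ j, workload m t g n j) * g n) / m + g n ^ 2
      - 2 * ((∑ j, workload m t g n j) * t (n + 1)) + m * t (n + 1) ^ 2 := by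
  obtain ⟨j₀, h₀, e⟩ := exists_workloadStep_eq (workload m t g n)
  rw [workload, e]
  set w := workload m t g n
  have hm : (0 : ℝ) < m := Nat.cast_pos.2 (NeZero.pos m)
  have hmin : m * w j₀ ≤ ∑ j, w j := by
    have : ∑ _j : Fin m, w j₀ ≤ ∑ j, w j :=
      Finset.sum_le_sum fun j _ => h₀ ▸ iInf_fin_le w j
    simpa using this
  have hgn := hg n
  have htn := ht (n + 1)
  calc ∑ j, max 0 (w j + (if j = j₀ then g n else 0) - t (n + 1)) ^ 2
      ≤ ∑ j, (w j + (if j = j₀ then g n else 0) - t (n + 1)) ^ 2 := by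
        refine Finset.sum_le_sum fun j _ => ?_
        rcases le_total 0 (w j + (if j = j₀ then g n else 0) - t (n + 1)) with h | h
        · rw [max_eq_right h]
        · rw [max_eq_left h]; simpa using sq_nonneg _
    _ = ∑ j, (w j ^ 2 + (if j = j₀ then 2 * w j * g n + g n ^ 2 - 2 * g n * t (n + 1) else 0)
          - 2 * w j * t (n + 1) + t (n + 1) ^ 2) := by
        refine Finset.sum_congr rfl fun j _ => ?_
        split_ifs <;> ring
    _ = ∑ j, w j ^ 2 + (2 * w j₀ * g n + g n ^ 2 - 2 * g n * t (n + 1))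
          - 2 * ((∑ j, w j) * t (n + 1)) + m * t (n + 1) ^ 2 := by
        simp only [Finset.sum_add_distrib, Finset.sum_sub_distrib, Finset.sum_ite_eq',
          Finset.mem_univ, if_true, ← Finset.sum_mul, ← Finset.mul_sum]
        simp; ring
    _ ≤ _ := by
        have h1 : w j₀ * g n ≤ (∑ j, w j) * g n / m := by
          rw [le_div_iff₀ hm]; nlinarith
        have h2 : 0 ≤ g n * t (n + 1) := mul_nonneg hgn htn
        have h3 : 2 * ((∑ j, w j) * g n) / m = 2 * ((∑ j, w j) * g n / m) := by ring
        rw [h3]; nlinarith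

/-- The server of job `j` stays occupied until that job departs, so that the loads seen by a
later job `n` bound the remaining sojourn time of job `j`. -/
lemma exists_waiting_add_le [NeZero m] {t g : ℕ → ℝ} (hg : ∀ n, 0 ≤ g n) {j n : ℕ} (hjn : j < n) :
    ∃ l, waiting m t g j + g j ≤ ∑ i ∈ Finset.Ioc j n, t i + workload m t g n l := by
  induction n, hjn using Nat.le_induction with
  | base =>
    obtain ⟨j₀, h₀, e⟩ := exists_workloadStep_eq (workload m t g j)
    refine ⟨j₀, ?_⟩
    have h := le_max_right 0 (workload m t g j j₀ + g j - t (j + 1))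
    rw [h₀] at h
    simp only [Nat.succ_eq_add_one, Nat.Ioc_succ_singleton, Finset.sum_singleton, workload, e,
      if_true, waiting]
    rw [h₀]
    linarith
  | succ n hn ih =>
    obtain ⟨l, hl⟩ := ih
    obtain ⟨j₀, -, e⟩ := exists_workloadStep_eq (workload m t g n)
    refine ⟨l, ?_⟩
    rw [Finset.sum_Ioc_succ_top (by omega), workload, e]
    have h := le_max_right 0 (workload m t g n l + (if l = j₀ then g n else 0) - t (n + 1))
    have h' : 0 ≤ (if l = j₀ then g n else 0) := by split_ifs <;> simp [hg]
    linarith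

/-- Once the work seen by job `n` has had time to be finished, only jobs from `n` on are left. -/
lemma queueBacklog_le [NeZero m] {t g : ℕ → ℝ} (hg : ∀ n, 0 ≤ g n) (n i : ℕ)
    (h : ∑ j, workload m t g n j ≤ ∑ l ∈ Finset.Ioc n (n + i), t l) :
    queueBacklog m t g (n + i) 0 ≤ i := by
  classical
  have hsub : ((Finset.range (n + i)).filter fun j =>
      ∑ l ∈ Finset.Ioc j (n + i), t l + 0 < waiting m t g j + g j) ⊆ Finset.Ico n (n + i) := by
    intro j hj
    rw [Finset.mem_filter, Finset.mem_range] at hj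
    refine Finset.mem_Ico.2 ⟨?_, hj.1⟩
    by_contra! hlt
    obtain ⟨l, hl⟩ := exists_waiting_add_le (m := m) (t := t) hg hlt
    have h1 : workload m t g n l ≤ ∑ j, workload m t g n j :=
      Finset.single_le_sum (fun j _ => workload_nonneg t g n j) (Finset.mem_univ l)
    have h2 : ∑ i ∈ Finset.Ioc j n, t i + ∑ l ∈ Finset.Ioc n (n + i), t l =
        ∑ l ∈ Finset.Ioc j (n + i), t l := by
      have e1 := sum_range_add_sum_Ioc t hlt.le
      have e2 := sum_range_add_sum_Ioc t (Nat.le_add_right n i)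
      have e3 := sum_range_add_sum_Ioc t hj.1.le
      linarith
    linarith [hj.2]
  simpa [queueBacklog] using Finset.card_le_card hsub

end Deterministic

/-! ### Reduction of the barrier system to the queue -/

lemma card_filter_rank_lt {α : Type*} [LinearOrder α] (S : Finset α) {k : ℕ} (hk : k ≤ S.card) :
    (S.filter fun w => (S.filter fun w' => w' < w).card < k).card = k := by
  induction S using Finset.induction_on_max with
  | empty => simp at hk; simp [hk]
  | insert a S ha ih =>
    have haS : a ∉ S := fun h => lt_irrefl _ (ha a h)
    rw [Finset.card_insert_of_notMem haS] at hk
    have h1 : ((insert a S).filter fun w' => w' < a) = S := by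
      rw [Finset.filter_insert, if_neg (lt_irrefl a), Finset.filter_true_of_mem ha]
    have h2 : ∀ w ∈ S, ((insert a S).filter fun w' => w' < w) = S.filter fun w' => w' < w :=
      fun w hw => by rw [Finset.filter_insert, if_neg (ha w hw).le.not_gt]
    rcases Nat.lt_or_ge S.card k with h | h
    · rw [Finset.filter_true_of_mem, Finset.card_insert_of_notMem haS]
      · omega
      · intro w hw
        rcases Finset.mem_insert.1 hw with rfl | hw
        · rwa [h1]
        · rw [h2 w hw]; exact (Finset.card_filter_le _ _).trans_lt h
    · rw [Finset.filter_insert, h1, if_neg (not_lt.2 h)]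
      rw [Finset.filter_congr fun w hw => by rw [h2 w hw]]
      exact ih h

/-- Moving the points of `sel` from positions at most `b` to `d` lowers the number of points up
to `t ≥ b` by the size of `sel`, unless `d ≤ t`. -/
lemma card_le_of_move {ι : Type*} [Fintype ι] [DecidableEq ι] (h : ι → ℝ) (sel : Finset ι)
    {b d t : ℝ} (hsel : ∀ w ∈ sel, h w ≤ b) (hbt : b ≤ t) :
    (Finset.univ.filter fun w => (if w ∈ sel then d else h w) ≤ t).card +
      (if d ≤ t then 0 else sel.card) = (Finset.univ.filter fun w => h w ≤ t).card := by
  split_ifs with hd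
  · rw [add_zero]
    congr 1
    ext w
    by_cases hw : w ∈ sel
    · simp [hw, hd, (hsel w hw).trans hbt]
    · simp [hw]
  · rw [← Finset.card_sdiff_add_card_eq_card (s := sel)
      (t := Finset.univ.filter fun w => h w ≤ t)
      (fun w hw => by simpa using (hsel w hw).trans hbt)]
    congr 2
    ext w
    by_cases hw : w ∈ sel <;> simp [hw, hd]

lemma isLeast_serviceStart {m : ℕ} [NeZero m] (u : Fin m → ℝ) (a : ℝ) :
    IsLeast {t : ℝ | a ≤ t ∧ ∃ j, u j ≤ t} (serviceStart u a) := by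
  obtain ⟨j₀, hj₀⟩ := exists_eq_ciInf_of_finite (f := u)
  have h : IsLeast {t : ℝ | a ≤ t ∧ ∃ j, u j ≤ t} (max a (u j₀)) := by
    refine ⟨⟨le_max_left _ _, j₀, le_max_right _ _⟩, ?_⟩
    rintro t ⟨h1, j, hj⟩
    exact max_le h1 (hj₀ ▸ (iInf_fin_le u j).trans hj)
  rw [serviceStart, h.csInf_eq]
  exact h

section

variable {s m k : ℕ} {f : Fin s → ℝ} {u : Fin m → ℝ} {a : ℝ}

/-- If from time `a` on there are `k` idle workers per idle server, then both systems start the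
job at the same time. -/
lemma jobStart_eq_serviceStart (hk : 0 < k)
    (h : ∀ t ≥ a, (idle f t).card = k * (Finset.univ.filter fun j => u j ≤ t).card) :
    jobStart k f a = serviceStart u a := by
  unfold jobStart serviceStart
  congr 1
  ext t
  refine and_congr_right fun ht => ?_
  rw [h t ht]
  constructor
  · intro hle
    have : 0 < (Finset.univ.filter fun j => u j ≤ t).card := by
      by_contra! h0
      rw [Nat.le_zero.1 h0] at hle
      omega
    obtain ⟨j, hj⟩ := Finset.card_pos.1 this
    exact ⟨j, by simpa using hj⟩
  · rintro ⟨j, hj⟩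
    exact Nat.le_mul_of_pos_right k (Finset.card_pos.2 ⟨j, by simpa using hj⟩)

lemma jobDeparture_eq (hk : 0 < k) (b : ℝ) (x : Fin k → ℝ) :
    jobDeparture b x = b + ⨆ i, x i := by
  have : Nonempty (Fin k) := ⟨⟨0, hk⟩⟩
  rw [jobDeparture, add_ciSup (Set.finite_range x).bddAbove]

/-- Serving a job preserves the ratio of idle workers to idle servers: `k` workers and one server
are moved to the common departure time. -/
lemma card_idle_nextFree [NeZero m] (hk : 0 < k) {x : Fin k → ℝ} (hx : 0 ≤ ⨆ i, x i)
    {u' : Fin m → ℝ}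
    (h : ∀ t ≥ a, (idle f t).card = k * (Finset.univ.filter fun j => u j ≤ t).card)
    (hu' : ∀ j, u' j = if u j ≤ serviceStart u a ∧ ∀ i < j, serviceStart u a < u i
      then serviceStart u a + ⨆ i, x i else u j) :
    ∀ t ≥ a, (idle (nextFree f a x) t).card =
      k * (Finset.univ.filter fun j => u' j ≤ t).card := by
  classical
  intro t hat
  have hstart := jobStart_eq_serviceStart hk h
  set b := serviceStart u a with hb
  set d := b + ⨆ i, x i with hd
  have hleast := isLeast_serviceStart u a
  rw [← hb] at hleast
  set sel := selected k f b with hsel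
  have hselb : ∀ w ∈ sel, f w ≤ b := fun w hw => by
    simpa [idle] using (Finset.mem_filter.1 hw).1
  have hf' : nextFree f a x = fun w => if w ∈ sel then d else f w := by
    ext w; rw [nextFree, hstart, jobDeparture_eq hk]
  obtain ⟨j₀, hj₀⟩ := exists_least_label hleast.1.2
  have hiff : ∀ j, (u j ≤ b ∧ ∀ i < j, b < u i) ↔ j ∈ ({j₀} : Finset (Fin m)) := fun j =>
    ⟨fun hj => Finset.mem_singleton.2 (least_label_unique hj hj₀),
      fun hj => Finset.mem_singleton.1 hj ▸ hj₀⟩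
  have hu'' : u' = fun j => if j ∈ ({j₀} : Finset (Fin m)) then d else u j := by
    ext j; rw [hu' j]; exact if_congr (hiff j) rfl rfl
  rw [hf', hu'']
  rcases le_or_gt b t with hbt | htb
  · have e1 := card_le_of_move f sel (d := d) hselb hbt
    have e2 := card_le_of_move u {j₀} (d := d) (b := b)
      (fun j hj => by rw [Finset.mem_singleton.1 hj]; exact hj₀.1) hbt
    have hcard : sel.card = k := by
      refine card_filter_rank_lt _ ?_
      rw [h b hleast.1.1]
      exact Nat.le_mul_of_pos_right k (Finset.card_pos.2 ⟨j₀, by simpa using hj₀.1⟩)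
    have e3 := h t hat
    rw [idle, ← e1, ← e2, hcard, Finset.card_singleton, mul_add] at e3
    unfold idle
    beta_reduce
    by_cases hdt : d ≤ t
    · rwa [if_pos hdt, if_pos hdt, mul_zero, add_zero, add_zero] at e3
    · rw [if_neg hdt, if_neg hdt, mul_one] at e3
      exact Nat.add_right_cancel e3
  · have hnone : ∀ j, ¬ u j ≤ t := fun j hj => absurd (hleast.2 ⟨hat, j, hj⟩) (not_le.2 htb)
    have h0 : (idle f t).card = 0 := by
      rw [h t hat, Finset.filter_false_of_mem fun j _ => hnone j]; simp
    have h0' : ∀ w, ¬ f w ≤ t := fun w hw =>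
      Finset.notMem_empty w (Finset.card_eq_zero.1 h0 ▸ by simpa [idle] using hw)
    have hdt : ¬ d ≤ t := by rw [not_le, hd]; linarith
    rw [idle, Finset.filter_false_of_mem, Finset.filter_false_of_mem]
    · simp
    · intro j _; beta_reduce; split_ifs <;> simp [hdt, hnone]
    · intro w _; split_ifs <;> simp [hdt, h0']

end

/-- There are always `k` idle workers per idle server, from the last arrival on. -/
lemma card_idle_freeTimes {s m k : ℕ} [NeZero m] (hk : 0 < k) (hs : s = k * m) {a : ℕ → ℝ}
    (ha : Monotone a) {x : ℕ → Fin k → ℝ} (hx : ∀ n, 0 ≤ ⨆ i, x n i) (n : ℕ) :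
    ∀ t ≥ a n, (idle (freeTimes s a x n) t).card =
      k * (Finset.univ.filter fun j => serverFree m a (fun n => ⨆ i, x n i) n j ≤ t).card := by
  induction n with
  | zero =>
    intro t _
    by_cases ht : 0 ≤ t <;> simp [idle, freeTimes, serverFree, ht, hs]
  | succ n ih =>
    intro t ht
    exact card_idle_nextFree hk (hx n) ih (fun j => serverFree_succ _ _ n j) t
      ((ha n.le_succ).trans ht)

lemma start_eq_queueStart {s m k : ℕ} [NeZero m] (hk : 0 < k) (hs : s = k * m) {a : ℕ → ℝ}
    (ha : Monotone a) {x : ℕ → Fin k → ℝ} (hx : ∀ n, 0 ≤ ⨆ i, x n i) (n : ℕ) :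
    start s a x n = queueStart m a (fun n => ⨆ i, x n i) n :=
  jobStart_eq_serviceStart hk (card_idle_freeTimes hk hs ha hx n)

lemma departure_eq_queueDeparture {s m k : ℕ} [NeZero m] (hk : 0 < k) (hs : s = k * m)
    {a : ℕ → ℝ} (ha : Monotone a) {x : ℕ → Fin k → ℝ} (hx : ∀ n, 0 ≤ ⨆ i, x n i) (n : ℕ) :
    departure s a x n = queueDeparture m a (fun n => ⨆ i, x n i) n := by
  rw [departure, jobDeparture_eq hk, start_eq_queueStart hk hs ha hx]
  rfl

/-! ### Exponential distributions and Rényi's formula -/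

lemma ae_nonneg_expMeasure (r : ℝ) : ∀ᵐ x ∂(expMeasure r), 0 ≤ x := by
  rw [ae_iff]
  have : {x : ℝ | ¬ 0 ≤ x} = Set.Iio 0 := by ext; simp
  rw [this, expMeasure, gammaMeasure, withDensity_apply _ measurableSet_Iio]
  exact lintegral_gammaPDF_of_nonpos le_rfl

lemma integrable_expMeasure_iff {r : ℝ} (hr : 0 < r) {f : ℝ → ℝ} :
    Integrable f (expMeasure r) ↔
      IntegrableOn (fun x => r * Real.exp (-(r * x)) * f x) (Set.Ici 0) := by
  rw [expMeasure, gammaMeasure, integrable_withDensity_iff_integrable_smul'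
    (f := gammaPDF 1 r) (measurable_gammaPDFReal 1 r).ennreal_ofReal
    (ae_of_all _ fun _ => ENNReal.ofReal_lt_top),
    ← integrable_indicator_iff measurableSet_Ici]
  refine iff_of_eq (congrArg (fun f => Integrable f volume) ?_)
  ext x
  by_cases hx : 0 ≤ x
  · have h : (0 : ℝ) ≤ r * Real.exp (-(r * x)) := by positivity
    simp [hx, gammaPDF_of_nonneg, ENNReal.toReal_ofReal h]
  · rw [gammaPDF_of_neg (not_le.1 hx)]; simp [hx]

lemma integral_expMeasure {r : ℝ} (hr : 0 < r) (f : ℝ → ℝ) :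
    ∫ x, f x ∂(expMeasure r) = ∫ x in Set.Ici 0, r * Real.exp (-(r * x)) * f x := by
  rw [expMeasure, gammaMeasure, integral_withDensity_eq_integral_toReal_smul
    (f := gammaPDF 1 r) (measurable_gammaPDFReal 1 r).ennreal_ofReal
    (ae_of_all _ fun _ => ENNReal.ofReal_lt_top),
    ← integral_indicator measurableSet_Ici]
  congr 1
  ext x
  by_cases hx : 0 ≤ x
  · have h : (0 : ℝ) ≤ r * Real.exp (-(r * x)) := by positivity
    simp [hx, gammaPDF_of_nonneg, ENNReal.toReal_ofReal h]
  · rw [gammaPDF_of_neg (not_le.1 hx)]; simp [hx]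

lemma integrable_pow_expMeasure {r : ℝ} (hr : 0 < r) (n : ℕ) :
    Integrable (fun x => x ^ n) (expMeasure r) := by
  rw [integrable_expMeasure_iff hr, integrableOn_Ici_iff_integrableOn_Ioi]
  have h := (integrableOn_rpow_mul_exp_neg_mul_rpow (p := 1) (s := n) (b := r)
    (by have : (0 : ℝ) ≤ n := n.cast_nonneg
        linarith) one_pos hr).const_mul r
  refine IntegrableOn.congr_fun h (fun x hx => ?_) measurableSet_Ioi
  simp only [Real.rpow_natCast, Real.rpow_one, neg_mul]
  ring

lemma integral_pow_expMeasure {r : ℝ} (hr : 0 < r) (n : ℕ) :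
    ∫ x, x ^ n ∂(expMeasure r) = n.factorial / r ^ n := by
  rw [integral_expMeasure hr, integral_Ici_eq_integral_Ioi]
  have h := Real.integral_rpow_mul_exp_neg_mul_Ioi (a := n + 1) (r := r) (by positivity) hr
  rw [add_sub_cancel_right, Real.Gamma_nat_eq_factorial] at h
  have e : ∀ x ∈ Set.Ioi (0 : ℝ), r * Real.exp (-(r * x)) * x ^ n =
      r * (x ^ (n : ℝ) * Real.exp (-(r * x))) := fun x _ => by
    rw [Real.rpow_natCast]; ring
  rw [setIntegral_congr_fun measurableSet_Ioi e, integral_const_mul, h,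
    show ((n : ℝ) + 1) = ((n + 1 : ℕ) : ℝ) by push_cast; rfl, Real.rpow_natCast, one_div, inv_pow]
  field_simp
  ring

lemma measureReal_expMeasure_Iic {r : ℝ} (hr : 0 < r) (x : ℝ) :
    (expMeasure r).real (Set.Iic x) = if 0 ≤ x then 1 - Real.exp (-(r * x)) else 0 := by
  have := isProbabilityMeasure_expMeasure hr
  rw [← cdf_eq_real, cdf_expMeasure_eq hr]

lemma measurable_iSup_fin {k : ℕ} : Measurable fun x : Fin k → ℝ => ⨆ i, x i := by
  exact Measurable.iSup fun i => measurable_pi_apply i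

lemma isProbabilityMeasure_maxExpLaw {k : ℕ} {μ : ℝ} (hμ : 0 < μ) :
    IsProbabilityMeasure (maxExpLaw k μ) := by
  have := isProbabilityMeasure_expMeasure hμ
  exact Measure.isProbabilityMeasure_map measurable_iSup_fin.aemeasurable

lemma measureReal_maxExpLaw_Iic {k : ℕ} (hk : 0 < k) {μ : ℝ} (hμ : 0 < μ) (x : ℝ) :
    (maxExpLaw k μ).real (Set.Iic x) = if 0 ≤ x then (1 - Real.exp (-(μ * x))) ^ k else 0 := by
  have := isProbabilityMeasure_expMeasure hμ
  have : Nonempty (Fin k) := ⟨⟨0, hk⟩⟩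
  rw [maxExpLaw, map_measureReal_apply measurable_iSup_fin measurableSet_Iic]
  have e : (fun x : Fin k → ℝ => ⨆ i, x i) ⁻¹' Set.Iic x = Set.univ.pi fun _ => Set.Iic x := by
    ext y
    simp [ciSup_le_iff (Set.finite_range y).bddAbove, Pi.le_def]
  rw [e, measureReal_def, Measure.pi_pi, ENNReal.toReal_prod]
  simp_rw [← measureReal_def, measureReal_expMeasure_Iic hμ]
  split_ifs <;> simp [hk.ne']

/-- The law of the sum of independent exponentials of rates `μ, 2μ, …, kμ`. -/
noncomputable def sumExpLaw (k : ℕ) (μ : ℝ) : Measure ℝ :=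
  (Measure.pi fun j : Fin k => expMeasure (((j : ℕ) + 1 : ℝ) * μ)).map fun y => ∑ j, y j

lemma measurable_sum_fin {k : ℕ} : Measurable fun y : Fin k → ℝ => ∑ j, y j :=
  Finset.measurable_fun_sum _ fun j _ => measurable_pi_apply j


section

variable {μ : ℝ} (hμ : 0 < μ)
include hμ

lemma isProbabilityMeasure_pi_expMeasure (k : ℕ) : IsProbabilityMeasure
    (Measure.pi fun j : Fin k => expMeasure (((j : ℕ) + 1 : ℝ) * μ)) := by
  have : ∀ j : Fin k, IsProbabilityMeasure (expMeasure (((j : ℕ) + 1 : ℝ) * μ)) :=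
    fun j => isProbabilityMeasure_expMeasure (by positivity)
  infer_instance

lemma isProbabilityMeasure_sumExpLaw (k : ℕ) : IsProbabilityMeasure (sumExpLaw k μ) := by
  have := isProbabilityMeasure_pi_expMeasure hμ k
  exact Measure.isProbabilityMeasure_map measurable_sum_fin.aemeasurable

/-- Conditioning on the exponential of largest rate. -/
lemma measureReal_sumExpLaw_succ (k : ℕ) (x : ℝ) :
    (sumExpLaw (k + 1) μ).real (Set.Iic x) =
      ∫ y, (sumExpLaw k μ).real (Set.Iic (x - y)) ∂(expMeasure ((k + 1) * μ)) := by
  have hp : ∀ j : Fin (k + 1), IsProbabilityMeasure (expMeasure (((j : ℕ) + 1 : ℝ) * μ)) :=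
    fun j => isProbabilityMeasure_expMeasure (by positivity)
  have hpk := isProbabilityMeasure_pi_expMeasure hμ k
  have hps := isProbabilityMeasure_sumExpLaw hμ k
  have hpe := hp (Fin.last k)
  have hmp := measurePreserving_piFinSuccAbove
    (fun j : Fin (k + 1) => expMeasure (((j : ℕ) + 1 : ℝ) * μ)) (Fin.last k)
  simp only [Fin.succAbove_last, Fin.val_castSucc, Fin.val_last] at hmp hpe
  have hadd : MeasurableSet {p : ℝ × (Fin k → ℝ) | p.1 + ∑ j, p.2 j ≤ x} :=
    measurableSet_le (measurable_fst.add (measurable_sum_fin.comp measurable_snd))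
      measurable_const
  rw [sumExpLaw, map_measureReal_apply measurable_sum_fin measurableSet_Iic]
  have e : (fun y : Fin (k + 1) → ℝ => ∑ j, y j) ⁻¹' Set.Iic x =
      MeasurableEquiv.piFinSuccAbove (fun _ : Fin (k + 1) => ℝ) (Fin.last k) ⁻¹'
        {p : ℝ × (Fin k → ℝ) | p.1 + ∑ j, p.2 j ≤ x} := by
    ext y
    simp [Fin.sum_univ_castSucc, Fin.init, add_comm]
  rw [e, measureReal_def, hmp.measure_preimage hadd.nullMeasurableSet,
    Measure.prod_apply hadd]
  have e2 : ∀ y : ℝ, (Measure.pi fun j : Fin k => expMeasure (((j : ℕ) + 1 : ℝ) * μ))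
      (Prod.mk y ⁻¹' {p : ℝ × (Fin k → ℝ) | p.1 + ∑ j, p.2 j ≤ x}) =
      sumExpLaw k μ (Set.Iic (x - y)) := by
    intro y
    rw [sumExpLaw, Measure.map_apply measurable_sum_fin measurableSet_Iic]
    congr 1
    ext z
    simp [le_sub_iff_add_le']
  simp_rw [e2]
  rw [← integral_toReal]
  · rfl
  · refine Measurable.aemeasurable ?_
    have : Antitone fun y => sumExpLaw k μ (Set.Iic (x - y)) := fun a b hab =>
      measure_mono (Set.Iic_subset_Iic.2 (by linarith))
    exact this.measurable
  · exact ae_of_all _ fun y => measure_lt_top _ _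

/-- Rényi's formula at the level of distribution functions. -/
lemma measureReal_sumExpLaw_Iic (k : ℕ) (x : ℝ) :
    (sumExpLaw k μ).real (Set.Iic x) = if 0 ≤ x then (1 - Real.exp (-(μ * x))) ^ k else 0 := by
  induction k generalizing x with
  | zero =>
    have := isProbabilityMeasure_pi_expMeasure hμ 0
    rw [sumExpLaw, map_measureReal_apply measurable_sum_fin measurableSet_Iic]
    by_cases hx : 0 ≤ x <;> simp [hx]
  | succ k ih =>
    rw [measureReal_sumExpLaw_succ hμ]
    simp_rw [ih]
    rw [integral_expMeasure (by positivity)]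
    rcases lt_or_ge x 0 with hx | hx
    · rw [if_neg (not_le.2 hx)]
      rw [setIntegral_congr_fun (g := fun _ => (0 : ℝ)) measurableSet_Ici]
      · simp
      · intro y hy
        have hy' : (0 : ℝ) ≤ y := hy
        dsimp only
        rw [if_neg (by linarith), mul_zero]
    rw [if_pos hx]
    have e1 : ∀ y ∈ Set.Ici (0 : ℝ), ((k : ℝ) + 1) * μ * Real.exp (-((k + 1) * μ * y)) *
        (if 0 ≤ x - y then (1 - Real.exp (-(μ * (x - y)))) ^ k else 0) =
        (Set.Iic x).indicator (fun y => (k + 1) * μ * Real.exp (-(μ * y)) *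
          (Real.exp (-(μ * y)) - Real.exp (-(μ * x))) ^ k) y := by
      intro y _
      by_cases hy : y ≤ x
      · rw [if_pos (by linarith), Set.indicator_of_mem (Set.mem_Iic.2 hy)]
        have h1 : Real.exp (-(μ * y)) - Real.exp (-(μ * x)) =
            Real.exp (-(μ * y)) * (1 - Real.exp (-(μ * (x - y)))) := by
          rw [mul_sub, ← Real.exp_add, mul_one]; ring_nf
        have h2 : Real.exp (-((k + 1) * μ * y)) =
            Real.exp (-(μ * y)) * Real.exp (-(μ * y)) ^ k := by
          rw [← Real.exp_nat_mul, ← Real.exp_add]; ring_nf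
        rw [h1, h2, mul_pow]; ring
      · rw [if_neg (by linarith), Set.indicator_of_notMem (by simpa using hy), mul_zero]
    rw [setIntegral_congr_fun measurableSet_Ici e1, setIntegral_indicator measurableSet_Iic,
      Set.Ici_inter_Iic, integral_Icc_eq_integral_Ioc, ← intervalIntegral.integral_of_le hx]
    have hderiv : ∀ y ∈ Set.uIcc 0 x, HasDerivAt
        (fun y => -(Real.exp (-(μ * y)) - Real.exp (-(μ * x))) ^ (k + 1))
        ((k + 1) * μ * Real.exp (-(μ * y)) *
          (Real.exp (-(μ * y)) - Real.exp (-(μ * x))) ^ k) y := by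
      intro y _
      have h := ((((hasDerivAt_id y).const_mul μ).neg.exp.sub_const
        (Real.exp (-(μ * x)))).pow (k + 1)).neg
      refine h.congr_deriv ?_
      push_cast [Nat.add_sub_cancel, id_eq, Pi.neg_apply]
      ring
    rw [intervalIntegral.integral_eq_sub_of_hasDerivAt hderiv
      (Continuous.intervalIntegrable (by fun_prop) _ _)]
    simp

/-- **Rényi's formula**: the maximum of `k` independent exponentials of rate `μ` has the law of a
sum of independent exponentials of rates `μ, 2μ, …, kμ`. -/
lemma maxExpLaw_eq_sumExpLaw {k : ℕ} (hk : 0 < k) : maxExpLaw k μ = sumExpLaw k μ := by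
  have := isProbabilityMeasure_maxExpLaw (k := k) hμ
  have := isProbabilityMeasure_sumExpLaw hμ k
  refine Measure.ext_of_Iic _ _ fun x => ?_
  rw [← measureReal_eq_measureReal_iff, measureReal_maxExpLaw_Iic hk hμ,
    measureReal_sumExpLaw_Iic hμ]

lemma integrable_eval_pi_expMeasure {k : ℕ} (j : Fin k) (n : ℕ) :
    Integrable (fun y : Fin k → ℝ => y j ^ n)
      (Measure.pi fun j : Fin k => expMeasure (((j : ℕ) + 1 : ℝ) * μ)) := by
  have : ∀ j : Fin k, IsProbabilityMeasure (expMeasure (((j : ℕ) + 1 : ℝ) * μ)) :=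
    fun j => isProbabilityMeasure_expMeasure (by positivity)
  have h : 0 < ((j : ℕ) + 1 : ℝ) * μ := by positivity
  exact (measurePreserving_eval (fun j : Fin k => expMeasure (((j : ℕ) + 1 : ℝ) * μ)) j
    ).integrable_comp_of_integrable (integrable_pow_expMeasure h n)

lemma memLp_maxExpLaw {k : ℕ} (hk : 0 < k) : MemLp (fun x : ℝ => x) 2 (maxExpLaw k μ) := by
  have := isProbabilityMeasure_pi_expMeasure hμ k
  rw [maxExpLaw_eq_sumExpLaw hμ hk, sumExpLaw,
    memLp_map_measure_iff (g := fun x : ℝ => x) aestronglyMeasurable_id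
      measurable_sum_fin.aemeasurable]
  refine memLp_finsetSum _ fun j _ => ?_
  rw [memLp_two_iff_integrable_sq (measurable_pi_apply j).aestronglyMeasurable]
  exact integrable_eval_pi_expMeasure hμ j 2

lemma integral_maxExpLaw {k : ℕ} (hk : 0 < k) :
    ∫ x, x ∂(maxExpLaw k μ) = (harmonic k : ℝ) / μ := by
  have : ∀ j : Fin k, IsProbabilityMeasure (expMeasure (((j : ℕ) + 1 : ℝ) * μ)) :=
    fun j => isProbabilityMeasure_expMeasure (by positivity)
  rw [maxExpLaw_eq_sumExpLaw hμ hk, sumExpLaw,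
    integral_map measurable_sum_fin.aemeasurable (f := fun x : ℝ => x) aestronglyMeasurable_id,
    integral_finsetSum _ fun j _ => by simpa using integrable_eval_pi_expMeasure hμ j 1]
  have e : ∀ j : Fin k, ∫ y : Fin k → ℝ, y j
      ∂(Measure.pi fun j : Fin k => expMeasure (((j : ℕ) + 1 : ℝ) * μ)) =
      1 / (((j : ℕ) + 1 : ℝ) * μ) := by
    intro j
    have h : 0 < ((j : ℕ) + 1 : ℝ) * μ := by positivity
    have h1 := (measurePreserving_eval (fun j : Fin k => expMeasure (((j : ℕ) + 1 : ℝ) * μ)) j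
      ).hasLaw.integral_eq
    have h2 := integral_pow_expMeasure h 1
    simp only [pow_one, Nat.factorial_one, Nat.cast_one] at h2
    exact h1.trans h2
  simp_rw [e]
  rw [Fin.sum_univ_eq_sum_range (fun j => 1 / (((j : ℕ) + 1 : ℝ) * μ)), harmonic]
  push_cast
  rw [Finset.sum_div]
  refine Finset.sum_congr rfl fun j _ => ?_
  field_simp

end

/-! ### Measurability of the workload -/

section Measurability

variable {α : Type*} [MeasurableSpace α] {m : ℕ} {t g : α → ℕ → ℝ}

lemma measurable_workloadStep {w : α → Fin m → ℝ} {t g : α → ℝ}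
    (hw : ∀ j, Measurable fun a => w a j)
    (ht : Measurable t) (hg : Measurable g) (j : Fin m) :
    Measurable fun a => workloadStep (w a) (t a) (g a) j := by
  classical
  have hinf : Measurable fun a => ⨅ i, w a i := Measurable.iInf hw
  have hS : MeasurableSet {a | IsServed (w a) j} := by
    simp only [IsServed, Set.ofPred_and, Set.ofPred_forall]
    exact (measurableSet_le (hw j) hinf).inter
      (MeasurableSet.iInter fun i => MeasurableSet.iInter fun _ => measurableSet_lt hinf (hw i))
  exact measurable_const.max ((Measurable.ite hS ((hw j).add hg) (hw j)).sub ht)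

lemma measurable_workload (ht : ∀ i, Measurable fun a => t a i)
    (hg : ∀ i, Measurable fun a => g a i)
    (n : ℕ) (j : Fin m) : Measurable fun a => workload m (t a) (g a) n j := by
  induction n generalizing j with
  | zero => exact measurable_const
  | succ n ih => exact measurable_workloadStep ih (ht _) (hg _) j

lemma measurable_waiting (ht : ∀ i, Measurable fun a => t a i) (hg : ∀ i, Measurable fun a => g a i)
    (n : ℕ) : Measurable fun a => waiting m (t a) (g a) n :=
  Measurable.iInf fun j => measurable_workload ht hg n j

lemma measurable_queueBacklog (ht : ∀ i, Measurable fun a => t a i)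
    (hg : ∀ i, Measurable fun a => g a i) (n : ℕ) (y : ℝ) :
    Measurable fun a => queueBacklog m (t a) (g a) n y := by
  classical
  simp only [queueBacklog, Finset.card_filter]
  refine Finset.measurable_fun_sum _ fun j _ => Measurable.ite ?_ measurable_const measurable_const
  exact measurableSet_lt ((Finset.measurable_fun_sum _ fun i _ => ht i).add_const y)
    ((measurable_waiting ht hg j).add (hg j))

end Measurability

/-! ### Loynes' scheme -/

section Loynes

variable {Ω : Type*} [MeasurableSpace Ω] {P : Measure Ω} [IsProbabilityMeasure P]

/-- A nondecreasing sequence that is bounded in probability converges almost surely; hence so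
does, in distribution, any sequence with the same one-dimensional laws. -/
lemma convergesInDistribution_of_monotone {E : Type*} [ConditionallyCompleteLinearOrder E]
    [TopologicalSpace E] [OrderTopology E] [TopologicalSpace.PseudoMetrizableSpace E]
    [MeasurableSpace E] [BorelSpace E] {Y M : ℕ → Ω → E}
    (hYM : ∀ n, IdentDistrib (Y n) (M n) P P) (hM : ∀ ω, Monotone fun n => M n ω)
    (htight : ∀ ε : ℝ, 0 < ε → ∃ K, ∀ n, P.real {ω | K < Y n ω} ≤ ε) :
    ConvergesInDistribution Y P := by
  have hYMm : ∀ n K, P.real {ω | K < Y n ω} = P.real {ω | K < M n ω} := fun n K => by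
    have := (hYM n).measure_mem_eq (measurableSet_Ioi (a := K))
    exact congrArg ENNReal.toReal this
  have hbdd : ∀ᵐ ω ∂P, BddAbove (Set.range fun n => M n ω) := by
    rw [ae_iff]
    refine le_antisymm (ENNReal.le_of_forall_pos_le_add fun ε hε _ => ?_) zero_le
    obtain ⟨K, hK⟩ := htight ε hε
    rw [zero_add]
    have hmono : Monotone fun n => {ω | K < M n ω} := fun a b hab ω hω =>
      lt_of_lt_of_le hω (hM ω hab)
    calc P {ω | ¬ BddAbove (Set.range fun n => M n ω)} ≤ P (⋃ n, {ω | K < M n ω}) := by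
          refine measure_mono fun ω hω => ?_
          obtain ⟨_, ⟨n, rfl⟩, h⟩ := not_bddAbove_iff.1 hω K
          exact Set.mem_iUnion.2 ⟨n, h⟩
      _ = ⨆ n, P {ω | K < M n ω} := hmono.measure_iUnion
      _ ≤ ε := iSup_le fun n => by
          have := hK n
          rw [hYMm, measureReal_def] at this
          rw [← ENNReal.ofReal_toReal (measure_ne_top P {ω | K < M n ω}),
            ← ENNReal.ofReal_coe_nnreal]
          exact ENNReal.ofReal_le_ofReal this
  obtain ⟨L, hL, hlim⟩ := measurable_limit_of_tendsto_metrizable_ae (μ := P) (L := atTop)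
    (fun n => (hYM n).aemeasurable_snd)
    (hbdd.mono fun ω hω => ⟨_, tendsto_atTop_ciSup (hM ω) hω⟩)
  have hconv := tendstoInDistribution_of_ae_tendsto (fun n => (hYM n).aemeasurable_snd)
    hL.aemeasurable hlim
  let ν : ProbabilityMeasure E := ⟨P.map L, Measure.isProbabilityMeasure_map hL.aemeasurable⟩
  refine ⟨ν, fun n => (hYM n).aemeasurable_fst, aemeasurable_id, ?_⟩
  have h1 := hconv.tendsto
  have e : (⟨(ν : Measure E).map id, Measure.isProbabilityMeasure_map aemeasurable_id⟩ :
      ProbabilityMeasure E) = ν := Subtype.ext Measure.map_id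
  rw [e]
  exact h1.congr fun n => Subtype.ext (hYM n).map_eq.symm

lemma ConvergesInDistribution.congr {E : Type*} [TopologicalSpace E] [MeasurableSpace E]
    [OpensMeasurableSpace E] {Y Y' : ℕ → Ω → E} (h : ConvergesInDistribution Y P)
    (hY : ∀ n, Y n =ᵐ[P] Y' n) : ConvergesInDistribution Y' P := by
  obtain ⟨ν, hν⟩ := h
  exact ⟨ν, hν.congr hY ae_eq_rfl⟩

lemma convergesInDistribution_congr {E : Type*} [TopologicalSpace E] [MeasurableSpace E]
    [OpensMeasurableSpace E] {Y Y' : ℕ → Ω → E} (hY : ∀ n, Y n =ᵐ[P] Y' n) :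
    ConvergesInDistribution Y P ↔ ConvergesInDistribution Y' P :=
  ⟨fun h => h.congr hY, fun h => h.congr fun n => (hY n).symm⟩

/-- Convergence in distribution entails boundedness in probability. -/
lemma ConvergesInDistribution.exists_eventually_lt {Y : ℕ → Ω → ℝ}
    (h : ConvergesInDistribution Y P) {p : ℝ} (hp : 0 < p) :
    ∃ K : ℕ, ∀ᶠ n in atTop, P.real {ω | (K : ℝ) < Y n ω} < p := by
  obtain ⟨ν, hν⟩ := h
  have hint : ⋂ K : ℕ, Set.Ici (K : ℝ) = ∅ := by
    ext x
    obtain ⟨K, hK⟩ := exists_nat_gt x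
    simpa using ⟨K, hK⟩
  have h0 : Tendsto (fun K : ℕ => (ν : Measure ℝ) (Set.Ici (K : ℝ))) atTop (𝓝 0) := by
    have := tendsto_measure_iInter_atTop (μ := (ν : Measure ℝ)) (s := fun K : ℕ => Set.Ici (K : ℝ))
      (fun K => measurableSet_Ici.nullMeasurableSet)
      (fun a b hab => Set.Ici_subset_Ici.2 (Nat.cast_le.2 hab)) ⟨0, measure_ne_top _ _⟩
    rwa [hint, measure_empty] at this
  obtain ⟨K, hK⟩ := (h0.eventually_lt_const (ENNReal.ofReal_pos.2 hp)).exists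
  refine ⟨K, ?_⟩
  have hlim := ProbabilityMeasure.limsup_measure_closed_le_of_tendsto hν.tendsto
    (isClosed_Ici (a := (K : ℝ)))
  have h1 := eventually_lt_of_limsup_lt (lt_of_le_of_lt hlim (by simpa using hK))
  filter_upwards [h1] with n hn
  rw [ProbabilityMeasure.coe_mk,
    Measure.map_apply_of_aemeasurable (hν.forall_aemeasurable n) measurableSet_Ici] at hn
  rw [measureReal_def]
  refine (ENNReal.toReal_lt_of_lt_ofReal (lt_of_le_of_lt (measure_mono ?_) hn))
  intro ω hω
  exact le_of_lt (show (K : ℝ) < Y n ω from hω)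

end Loynes

/-- Reversal of the order of the indices `0, …, n`; larger indices stay in place. -/
def rev (n i : ℕ) : ℕ := if i ≤ n then n - i else i

lemma rev_injective (n : ℕ) : Function.Injective (rev n) := by
  intro i j h
  unfold rev at h
  split_ifs at h <;> omega

lemma rev_succ_succ {n i : ℕ} (h : i ≤ n) : rev (n + 1) (i + 1) = rev n i := by
  unfold rev
  split_ifs <;> omega

section

variable {Ω : Type*} [MeasurableSpace Ω] {P : Measure Ω} {lam : ℝ}
  {ν : Measure ℝ} {T G : ℕ → Ω → ℝ}

/-- Reversing the order of the first jobs does not change the law of iid inputs. -/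
lemma identDistrib_rev (hT : ∀ n, HasLaw (T n) (expMeasure lam) P) (hG : ∀ n, HasLaw (G n) ν P)
    (hind : iIndepFun (Sum.elim T G) P) (n : ℕ) :
    IdentDistrib (fun ω i => Sum.elim T G i ω)
      (fun ω i => Sum.elim T G (Sum.map (rev n) (rev n) i) ω) P P := by
  refine IdentDistrib.pi (X := Sum.elim T G)
    (Y := fun i => Sum.elim T G (Sum.map (rev n) (rev n) i)) (fun i => ?_) hind
    (hind.precomp ((rev_injective n).sumMap (rev_injective n)))
  rcases i with i | i
  · exact ⟨(hT _).aemeasurable, (hT _).aemeasurable, (hT _).map_eq.trans (hT _).map_eq.symm⟩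
  · exact ⟨(hG _).aemeasurable, (hG _).aemeasurable, (hG _).map_eq.trans (hG _).map_eq.symm⟩

lemma identDistrib_comp_rev (hT : ∀ n, HasLaw (T n) (expMeasure lam) P)
    (hG : ∀ n, HasLaw (G n) ν P) (hind : iIndepFun (Sum.elim T G) P) (n : ℕ) {E : Type*}
    [MeasurableSpace E] {F : (ℕ → ℝ) → (ℕ → ℝ) → E}
    (hF : Measurable fun z : ℕ ⊕ ℕ → ℝ => F (fun i => z (.inl i)) (fun i => z (.inr i))) :
    IdentDistrib (fun ω => F (fun i => T i ω) (fun i => G i ω))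
      (fun ω => F (fun i => T (rev n i) ω) (fun i => G (rev n i) ω)) P P :=
  (identDistrib_rev hT hG hind n).comp hF

/-- A quantity that depends on finitely many inputs is independent of any other input. -/
lemma indepFun_of_dependsOn (hT : ∀ n, AEMeasurable (T n) P) (hG : ∀ n, AEMeasurable (G n) P)
    (hind : iIndepFun (Sum.elim T G) P) {F : (ℕ → ℝ) → (ℕ → ℝ) → ℝ}
    (hF : Measurable fun z : ℕ ⊕ ℕ → ℝ => F (fun i => z (.inl i)) (fun i => z (.inr i)))
    (S : Finset (ℕ ⊕ ℕ))
    (hS : ∀ t g t' g', (∀ i, .inl i ∈ S → t i = t' i) → (∀ i, .inr i ∈ S → g i = g' i) →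
      F t g = F t' g') {l : ℕ ⊕ ℕ} (hl : l ∉ S) :
    IndepFun (fun ω => F (fun i => T i ω) (fun i => G i ω)) (Sum.elim T G l) P := by
  classical
  have hae : ∀ i, AEMeasurable (Sum.elim T G i) P := by
    rintro (i | i)
    · exact hT i
    · exact hG i
  have h := hind.indepFun_finset₀ S {l} (Finset.disjoint_singleton_right.2 hl) hae
  -- the missing coordinates are irrelevant and may be set to zero
  let ext : (S → ℝ) → (ℕ ⊕ ℕ → ℝ) := fun x i => if h : i ∈ S then x ⟨i, h⟩ else 0
  have hext : Measurable ext := by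
    refine measurable_pi_lambda _ fun i => ?_
    by_cases h : i ∈ S
    · simpa [ext, h] using measurable_pi_apply (⟨i, h⟩ : S)
    · simp [ext, h]
  have hproj : Measurable fun x : ({l} : Finset (ℕ ⊕ ℕ)) → ℝ =>
      x ⟨l, Finset.mem_singleton_self l⟩ := measurable_pi_apply _
  have h2 := h.comp (φ := fun x => F (fun i => ext x (.inl i)) (fun i => ext x (.inr i)))
    (ψ := fun x => x ⟨l, Finset.mem_singleton_self l⟩) (hF.comp hext)
    hproj
  refine h2.congr (ae_of_all _ fun ω => ?_) ae_eq_rfl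
  refine Eq.symm (hS _ _ _ _ (fun i hi => ?_) (fun i hi => ?_))
  · simp [ext, hi]
  · simp [ext, hi]

end

/-! ### Grouping independent families -/

/-- Disjoint blocks of an independent family are independent. -/
lemma iIndepFun_curry {Ω : Type*} [MeasurableSpace Ω] {P : Measure Ω} {ι : Type*} {κ : ι → Type*}
    [Countable ι] [∀ i, Countable (κ i)] {X : (i : ι) → κ i → Ω → ℝ}
    (hX : ∀ i j, AEMeasurable (X i j) P) (h : iIndepFun (fun p : (i : ι) × κ i => X p.1 p.2) P) :
    iIndepFun (fun i ω j => X i j ω) P := by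
  have := h.isProbabilityMeasure
  have : ∀ i j, IsProbabilityMeasure (P.map (X i j)) :=
    fun i j => Measure.isProbabilityMeasure_map (hX i j)
  have hblock : ∀ i, P.map (fun ω j => X i j ω) = Measure.infinitePi fun j => P.map (X i j) :=
    fun i => (iIndepFun_iff_map_fun_eq_infinitePi_map₀' (hX i)).1
      (h.precomp (g := fun j : κ i => (⟨i, j⟩ : (i : ι) × κ i)) sigma_mk_injective)
  have hall := (iIndepFun_iff_map_fun_eq_infinitePi_map₀' (fun p : (i : ι) × κ i => hX p.1 p.2)).1 h
  have hae : AEMeasurable (fun ω (p : (i : ι) × κ i) => X p.1 p.2 ω) P :=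
    aemeasurable_pi_iff.2 fun p => hX p.1 p.2
  rw [iIndepFun_iff_map_fun_eq_infinitePi_map₀' fun i => aemeasurable_pi_iff.2 (hX i)]
  simp_rw [hblock]
  rw [← Measure.infinitePi_map_piCurry (fun i j => P.map (X i j)), ← hall,
    AEMeasurable.map_map_of_aemeasurable (MeasurableEquiv.measurable _).aemeasurable hae]
  rfl

/-! ### Queues with square-integrable service times -/

/-- Exponential inter-arrival times of rate `lam` and independent iid service times of a law `ν`
with finite second moment. -/
structure QueueInput {Ω : Type*} [MeasurableSpace Ω] (lam : ℝ) (ν : Measure ℝ) (T G : ℕ → Ω → ℝ)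
    (P : Measure Ω) : Prop where
  rate_pos : 0 < lam
  interarrival_law : ∀ n, HasLaw (T n) (expMeasure lam) P
  service_law : ∀ n, HasLaw (G n) ν P
  indep : iIndepFun (Sum.elim T G) P
  service_nonneg : ∀ᵐ x ∂ν, 0 ≤ x
  service_memLp : MemLp (fun x : ℝ => x) 2 ν

namespace QueueInput

variable {Ω : Type*} [MeasurableSpace Ω] {P : Measure Ω} {lam : ℝ}
  {ν : Measure ℝ} {T G : ℕ → Ω → ℝ}

lemma ae_interarrival_nonneg (h : QueueInput lam ν T G P) : ∀ᵐ ω ∂P, ∀ n, 0 ≤ T n ω :=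
  ae_all_iff.2 fun n => ((h.interarrival_law n).ae_iff
    (p := fun x : ℝ => 0 ≤ x) (measurableSet_setOfPred.1 measurableSet_Ici)).2
      (ae_nonneg_expMeasure lam)

lemma ae_service_nonneg (h : QueueInput lam ν T G P) : ∀ᵐ ω ∂P, ∀ n, 0 ≤ G n ω :=
  ae_all_iff.2 fun n => ((h.service_law n).ae_iff
    (p := fun x : ℝ => 0 ≤ x) (measurableSet_setOfPred.1 measurableSet_Ici)).2 h.service_nonneg

lemma memLp_interarrival (h : QueueInput lam ν T G P) (n : ℕ) : MemLp (T n) 2 P := by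
  have h1 : MemLp (fun x : ℝ => x) 2 (expMeasure lam) :=
    (memLp_two_iff_integrable_sq aestronglyMeasurable_id).2 (integrable_pow_expMeasure h.rate_pos 2)
  rw [← (h.interarrival_law n).map_eq, memLp_map_measure_iff (g := fun x : ℝ => x)
    aestronglyMeasurable_id (h.interarrival_law n).aemeasurable] at h1
  exact h1

lemma memLp_service (h : QueueInput lam ν T G P) (n : ℕ) : MemLp (G n) 2 P := by
  have h1 := h.service_memLp
  rw [← (h.service_law n).map_eq, memLp_map_measure_iff (g := fun x : ℝ => x)
    aestronglyMeasurable_id (h.service_law n).aemeasurable] at h1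
  exact h1

lemma integral_interarrival (h : QueueInput lam ν T G P) (n : ℕ) : ∫ ω, T n ω ∂P = 1 / lam := by
  have := integral_pow_expMeasure h.rate_pos 1
  rw [(h.interarrival_law n).integral_eq]
  simpa using this

lemma integral_service (h : QueueInput lam ν T G P) (n : ℕ) : ∫ ω, G n ω ∂P = ∫ x, x ∂ν :=
  (h.service_law n).integral_eq

lemma integral_sq_interarrival (h : QueueInput lam ν T G P) (n : ℕ) :
    ∫ ω, T n ω ^ 2 ∂P = 2 / lam ^ 2 := by
  have h2 := integral_pow_expMeasure h.rate_pos 2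
  have := (h.interarrival_law n).integral_comp (f := fun x : ℝ => x ^ 2)
    (by fun_prop)
  simp only [Function.comp_def] at this
  rw [this, h2]
  norm_num

lemma integral_sq_service (h : QueueInput lam ν T G P) (n : ℕ) :
    ∫ ω, G n ω ^ 2 ∂P = ∫ x, x ^ 2 ∂ν :=
  (h.service_law n).integral_comp (f := fun x : ℝ => x ^ 2) (by fun_prop)

lemma mgf_interarrival (h : QueueInput lam ν T G P) (n : ℕ) :
    mgf (T n) P (-1) = lam / (lam + 1) := by
  have hl := h.rate_pos
  have h1 := (h.interarrival_law n).integral_comp (f := fun x : ℝ => Real.exp (-1 * x))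
    (by fun_prop)
  have h2 := integral_pow_expMeasure (by linarith : 0 < lam + 1) 0
  rw [integral_expMeasure (by linarith)] at h2
  have h3 : ∫ x in Set.Ici 0, lam * Real.exp (-(lam * x)) * Real.exp (-1 * x) =
      lam / (lam + 1) * ∫ x in Set.Ici 0, (lam + 1) * Real.exp (-((lam + 1) * x)) * x ^ 0 := by
    rw [← integral_const_mul]
    congr 1
    ext x
    rw [mul_assoc, ← Real.exp_add]
    field_simp
    ring_nf
  rw [mgf]
  simp only [Function.comp_def] at h1
  rw [h1, integral_expMeasure hl, h3, h2]
  simp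

lemma aemeasurable_input (h : QueueInput lam ν T G P) :
    AEMeasurable (fun ω (i : ℕ ⊕ ℕ) => Sum.elim T G i ω) P := by
  refine aemeasurable_pi_iff.2 ?_
  rintro (i | i)
  · exact (h.interarrival_law i).aemeasurable
  · exact (h.service_law i).aemeasurable

lemma aemeasurable_comp (h : QueueInput lam ν T G P) {E : Type*} [MeasurableSpace E]
    {F : (ℕ → ℝ) → (ℕ → ℝ) → E}
    (hF : Measurable fun z : ℕ ⊕ ℕ → ℝ => F (fun i => z (.inl i)) (fun i => z (.inr i))) :
    AEMeasurable (fun ω => F (fun i => T i ω) (fun i => G i ω)) P :=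
  hF.comp_aemeasurable h.aemeasurable_input

variable {m : ℕ}

lemma measurable_workload_coord (n : ℕ) (j : Fin m) : Measurable fun z : ℕ ⊕ ℕ → ℝ =>
    workload m (fun i => z (.inl i)) (fun i => z (.inr i)) n j :=
  measurable_workload (t := fun z : ℕ ⊕ ℕ → ℝ => fun i => z (.inl i))
    (fun _ => measurable_pi_apply _) (fun _ => measurable_pi_apply _) n j

lemma measurable_waiting_coord (n : ℕ) : Measurable fun z : ℕ ⊕ ℕ → ℝ =>
    waiting m (fun i => z (.inl i)) (fun i => z (.inr i)) n :=
  measurable_waiting (t := fun z : ℕ ⊕ ℕ → ℝ => fun i => z (.inl i))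
    (fun _ => measurable_pi_apply _) (fun _ => measurable_pi_apply _) n

lemma measurable_queueBacklog_coord (n : ℕ) (y : ℝ) : Measurable fun z : ℕ ⊕ ℕ → ℝ =>
    queueBacklog m (fun i => z (.inl i)) (fun i => z (.inr i)) n y :=
  measurable_queueBacklog (t := fun z : ℕ ⊕ ℕ → ℝ => fun i => z (.inl i))
    (fun _ => measurable_pi_apply _) (fun _ => measurable_pi_apply _) n y

lemma measurable_sum_workload_coord (n : ℕ) : Measurable fun z : ℕ ⊕ ℕ → ℝ =>
    ∑ j, workload m (fun i => z (.inl i)) (fun i => z (.inr i)) n j :=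
  Finset.measurable_fun_sum _ fun j _ => measurable_workload_coord n j

lemma ae_sum_workload_nonneg (n : ℕ) :
    0 ≤ᵐ[P] fun ω => ∑ j, workload m (fun i => T i ω) (fun i => G i ω) n j :=
  ae_of_all _ fun _ => Finset.sum_nonneg fun j _ => workload_nonneg _ _ n j

/-! ### Stability below the critical load -/

lemma memLp_workload [NeZero m] (h : QueueInput lam ν T G P) (n : ℕ) (j : Fin m) :
    MemLp (fun ω => workload m (fun i => T i ω) (fun i => G i ω) n j) 2 P := by
  have hsum : MemLp (fun ω => ∑ i ∈ Finset.range n, G i ω) 2 P :=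
    memLp_finsetSum _ fun i _ => h.memLp_service i
  refine hsum.mono (h.aemeasurable_comp (F := fun t g => workload m t g n j)
    (measurable_workload_coord n j)).aestronglyMeasurable ?_
  filter_upwards [h.ae_interarrival_nonneg, h.ae_service_nonneg] with ω ht hg
  rw [Real.norm_of_nonneg (workload_nonneg _ _ _ _),
    Real.norm_of_nonneg (Finset.sum_nonneg fun i _ => hg i)]
  exact workload_le_sum ht hg n j

lemma memLp_sum_workload [NeZero m] (h : QueueInput lam ν T G P) (n : ℕ) :
    MemLp (fun ω => ∑ j, workload m (fun i => T i ω) (fun i => G i ω) n j) 2 P :=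
  memLp_finsetSum _ fun j _ => h.memLp_workload n j

lemma workload_congr {t g t' g' : ℕ → ℝ} (n : ℕ) (ht : ∀ i ≤ n, t i = t' i)
    (hg : ∀ i < n, g i = g' i) : workload m t g n = workload m t' g' n := by
  induction n with
  | zero => rfl
  | succ n ih =>
    rw [workload, workload, ih (fun i hi => ht i (by omega)) (fun i hi => hg i (by omega)),
      ht _ le_rfl, hg n (by omega)]

/-- The work seen by job `n` is independent of the inputs that come later. -/
lemma indepFun_sum_workload (h : QueueInput lam ν T G P) (n : ℕ) {l : ℕ ⊕ ℕ}
    (hl : ∀ i < n, l ≠ .inr i) (hl' : ∀ i ≤ n, l ≠ .inl i) :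
    IndepFun (fun ω => ∑ j, workload m (fun i => T i ω) (fun i => G i ω) n j)
      (Sum.elim T G l) P := by
  classical
  refine indepFun_of_dependsOn (F := fun t g => ∑ j, workload m t g n j)
    (fun n => (h.interarrival_law n).aemeasurable)
    (fun n => (h.service_law n).aemeasurable) h.indep (measurable_sum_workload_coord n)
    ((Finset.range (n + 1)).image Sum.inl ∪ (Finset.range n).image Sum.inr) ?_ ?_
  · intro t g t' g' ht hg
    rw [workload_congr n (fun i hi => ht i ?_) (fun i hi => hg i ?_)]
    · simpa using Nat.lt_succ_of_le hi
    · simpa using hi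
  · simp only [Finset.mem_union, Finset.mem_image, Finset.mem_range, not_or, not_exists, not_and]
    exact ⟨fun i hi he => hl' i (by omega) he.symm, fun i hi he => hl i hi he.symm⟩

variable [IsProbabilityMeasure P]

/-- Mean drift of the sum of squared loads. -/
lemma integral_sum_sq_workload_succ_le [NeZero m] (h : QueueInput lam ν T G P) (n : ℕ) :
    ∫ ω, ∑ j, workload m (fun i => T i ω) (fun i => G i ω) (n + 1) j ^ 2 ∂P ≤
      ∫ ω, ∑ j, workload m (fun i => T i ω) (fun i => G i ω) n j ^ 2 ∂P
      - 2 * (1 / lam - (∫ x, x ∂ν) / m) *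
        ∫ ω, ∑ j, workload m (fun i => T i ω) (fun i => G i ω) n j ∂P
      + (∫ x, x ^ 2 ∂ν + m * (2 / lam ^ 2)) := by
  set W : ℕ → Ω → Fin m → ℝ := fun n ω => workload m (fun i => T i ω) (fun i => G i ω) n with hW
  set Q : Ω → ℝ := fun ω => ∑ j, W n ω j with hQ
  have hV : ∀ n, Integrable (fun ω => ∑ j, W n ω j ^ 2) P := fun n =>
    integrable_finsetSum _ fun j _ => (h.memLp_workload n j).integrable_sq
  have hQint : Integrable Q P := (h.memLp_sum_workload n).integrable (by norm_num)
  have hGint := (h.memLp_service n).integrable (q := 2) (by norm_num)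
  have hTint := (h.memLp_interarrival (n + 1)).integrable (q := 2) (by norm_num)
  have hQG : IndepFun Q (G n) P := h.indepFun_sum_workload n (l := .inr n)
    (fun i hi he => by simp only [Sum.inr.injEq] at he; omega) (fun i hi he => by simp at he)
  have hQT : IndepFun Q (T (n + 1)) P := h.indepFun_sum_workload n (l := .inl (n + 1))
    (fun i hi he => by simp at he) (fun i hi he => by simp only [Sum.inl.injEq] at he; omega)
  have i1 : Integrable (fun ω => Q ω * G n ω) P := hQG.integrable_mul hQint hGint
  have i2 : Integrable (fun ω => Q ω * T (n + 1) ω) P := hQT.integrable_mul hQint hTint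
  have i3 := (h.memLp_service n).integrable_sq
  have i4 := (h.memLp_interarrival (n + 1)).integrable_sq
  have e1 : ∫ ω, Q ω * G n ω ∂P = (∫ ω, Q ω ∂P) * ∫ x, x ∂ν := by
    rw [hQG.integral_fun_mul_eq_mul_integral hQint.1 hGint.1, h.integral_service]
  have e2 : ∫ ω, Q ω * T (n + 1) ω ∂P = (∫ ω, Q ω ∂P) * (1 / lam) := by
    rw [hQT.integral_fun_mul_eq_mul_integral hQint.1 hTint.1, h.integral_interarrival]
  have j1 : Integrable (fun ω => ∑ j, W n ω j ^ 2 + 2 * (Q ω * G n ω) / m) P :=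
    (hV n).add ((i1.const_mul 2).div_const _)
  have j2 : Integrable (fun ω => ∑ j, W n ω j ^ 2 + 2 * (Q ω * G n ω) / m + G n ω ^ 2) P :=
    j1.add i3
  have j3 : Integrable (fun ω => ∑ j, W n ω j ^ 2 + 2 * (Q ω * G n ω) / m + G n ω ^ 2
      - 2 * (Q ω * T (n + 1) ω)) P := j2.sub (i2.const_mul 2)
  calc ∫ ω, ∑ j, W (n + 1) ω j ^ 2 ∂P
      ≤ ∫ ω, (∑ j, W n ω j ^ 2 + 2 * (Q ω * G n ω) / m + G n ω ^ 2
          - 2 * (Q ω * T (n + 1) ω) + m * T (n + 1) ω ^ 2) ∂P := by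
        refine integral_mono_ae (hV (n + 1)) (j3.add (i4.const_mul _)) ?_
        filter_upwards [h.ae_interarrival_nonneg, h.ae_service_nonneg] with ω ht hg
        exact sum_sq_workload_succ_le ht hg n
    _ = _ := by
        rw [integral_add j3 (i4.const_mul _), integral_sub j2 (i2.const_mul 2), integral_add j1 i3,
          integral_add (hV n) ((i1.const_mul 2).div_const _), integral_div, integral_const_mul,
          integral_const_mul, integral_const_mul, e1, e2, h.integral_sq_service,
          h.integral_sq_interarrival]
        ring

/-- The mean work seen by job `n` is nondecreasing in `n`. -/
lemma monotone_integral_sum_workload [NeZero m] (h : QueueInput lam ν T G P) :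
    Monotone fun n => ∫ ω, ∑ j, workload m (fun i => T i ω) (fun i => G i ω) n j ∂P := by
  refine monotone_nat_of_le_succ fun n => ?_
  have hid := fun n => identDistrib_comp_rev h.interarrival_law h.service_law h.indep n
    (F := fun t g => ∑ j, workload m t g n j) (measurable_sum_workload_coord n)
  have hint := fun n => (h.memLp_sum_workload (m := m) n).integrable (q := 2) (by norm_num)
  rw [(hid n).integral_eq, (hid (n + 1)).integral_eq]
  refine integral_mono ((hid n).integrable_iff.1 (hint n))
    ((hid (n + 1)).integrable_iff.1 (hint (n + 1))) fun ω => ?_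
  refine (loadLE_workload_succ n (fun i _ hi => ?_) (fun i hi => ?_)).sum_le
  · rw [rev_succ_succ hi]
  · rw [rev_succ_succ hi.le]

/-- A nondecreasing sequence that enters the drift of a nonnegative sequence is bounded. -/
lemma mul_le_of_drift {V q : ℕ → ℝ} {δ c : ℝ} (hV : ∀ n, 0 ≤ V n) (hq : Monotone q) (hδ : 0 < δ)
    (hdrift : ∀ n, V (n + 1) ≤ V n - δ * q n + c) (n : ℕ) : δ * q n ≤ c := by
  by_contra! hlt
  have key : ∀ N : ℕ, V (n + N) ≤ V n - N * (δ * q n - c) := by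
    intro N
    induction N with
    | zero => simp
    | succ N ih =>
      have h1 := hdrift (n + N)
      have h2 : δ * q n ≤ δ * q (n + N) := mul_le_mul_of_nonneg_left (hq (by omega)) hδ.le
      push_cast
      rw [← add_assoc]
      linarith
  obtain ⟨N, hN⟩ := exists_nat_gt (V n / (δ * q n - c))
  rw [div_lt_iff₀ (by linarith)] at hN
  linarith [key N, hV (n + N)]

lemma exists_integral_sum_workload_le [NeZero m] (h : QueueInput lam ν T G P)
    (hstab : ∫ x, x ∂ν < m / lam) :
    ∃ C, ∀ n, ∫ ω, ∑ j, workload m (fun i => T i ω) (fun i => G i ω) n j ∂P ≤ C := by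
  have hm : (0 : ℝ) < m := Nat.cast_pos.2 (NeZero.pos m)
  have hδ : 0 < 2 * (1 / lam - (∫ x, x ∂ν) / m) := by
    have : (∫ x, x ∂ν) / m < 1 / lam := by
      rw [div_lt_iff₀ hm]
      calc _ < _ := hstab
        _ = _ := by ring
    linarith
  refine ⟨(∫ x, x ^ 2 ∂ν + m * (2 / lam ^ 2)) / (2 * (1 / lam - (∫ x, x ∂ν) / m)), fun n => ?_⟩
  rw [le_div_iff₀' hδ]
  exact mul_le_of_drift (V := fun n =>
      ∫ ω, ∑ j, workload m (fun i => T i ω) (fun i => G i ω) n j ^ 2 ∂P)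
    (fun n => integral_nonneg fun ω => Finset.sum_nonneg fun j _ => sq_nonneg _)
    h.monotone_integral_sum_workload hδ h.integral_sum_sq_workload_succ_le n

lemma measureReal_lt_le_div {Y : Ω → ℝ} (hY : 0 ≤ᵐ[P] Y) (hint : Integrable Y P) {C K : ℝ}
    (hC : ∫ ω, Y ω ∂P ≤ C) (hK : 0 < K) : P.real {ω | K < Y ω} ≤ C / K := by
  rw [le_div_iff₀' hK]
  refine le_trans (mul_le_mul_of_nonneg_left (measureReal_mono ?_) hK.le)
    ((mul_meas_ge_le_integral_of_nonneg hY hint K).trans hC)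
  exact fun ω hω => le_of_lt (show K < Y ω from hω)

/-- Below the critical load the delay converges in distribution. -/
lemma convergesInDistribution_delay [NeZero m] (h : QueueInput lam ν T G P)
    (hstab : ∫ x, x ∂ν < m / lam) :
    ConvergesInDistribution
      (fun n ω => waiting m (fun i => T i ω) (fun i => G i ω) n + G n ω) P := by
  have hmeas : ∀ n, Measurable fun z : ℕ ⊕ ℕ → ℝ =>
      waiting m (fun i => z (.inl i)) (fun i => z (.inr i)) n + z (.inr n) := fun n =>
    (measurable_waiting_coord n).add (measurable_pi_apply _)
  refine convergesInDistribution_of_monotone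
    (fun n => identDistrib_comp_rev h.interarrival_law h.service_law h.indep n
      (F := fun t g => waiting m t g n + g n) (hmeas n)) (fun ω => ?_) fun ε hε => ?_
  · refine monotone_nat_of_le_succ fun n => add_le_add ?_ (by simp [rev])
    refine (loadLE_workload_succ n (fun i _ hi => ?_) (fun i hi => ?_)).iInf_le
    · rw [rev_succ_succ hi]
    · rw [rev_succ_succ hi.le]
  · obtain ⟨C, hC⟩ := h.exists_integral_sum_workload_le hstab
    have hQint := fun n => (h.memLp_sum_workload (m := m) n).integrable (q := 2) (by norm_num)
    have hGint := fun n => (h.memLp_service n).integrable (q := 2) (by norm_num)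
    set D := |C + ∫ x, x ∂ν| + 1 with hD
    have hDpos : 0 < D := by positivity
    refine ⟨D / ε, fun n => ?_⟩
    have hle : ∫ ω, (∑ j, workload m (fun i => T i ω) (fun i => G i ω) n j + G n ω) ∂P ≤ D := by
      rw [integral_add (hQint n) (hGint n), h.integral_service]
      linarith [hC n, le_abs_self (C + ∫ x, x ∂ν)]
    have hmarkov := measureReal_lt_le_div (K := D / ε)
      (Y := fun ω => ∑ j, workload m (fun i => T i ω) (fun i => G i ω) n j + G n ω) (by
        filter_upwards [h.ae_service_nonneg] with ω hg
        exact add_nonneg (Finset.sum_nonneg fun j _ => workload_nonneg _ _ n j) (hg n))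
      ((hQint n).add (hGint n)) hle (by positivity)
    rw [div_div_cancel₀ hDpos.ne'] at hmarkov
    refine le_trans (measureReal_mono fun ω hω => ?_) hmarkov
    refine lt_of_lt_of_le (show D / ε < _ from hω) (add_le_add ?_ le_rfl)
    exact (waiting_le _ _ n 0).trans
      (Finset.single_le_sum (fun j _ => workload_nonneg _ _ n j) (Finset.mem_univ _))

/-- Chernoff bound for the time spanned by `i` arrivals. -/
lemma measureReal_sum_interarrival_le (h : QueueInput lam ν T G P) (n i : ℕ) (S : ℝ) :
    P.real {ω | ∑ l ∈ Finset.Ioc n (n + i), T l ω ≤ S} ≤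
      Real.exp S * (lam / (lam + 1)) ^ i := by
  have hind : iIndepFun T P := h.indep.precomp (g := Sum.inl) Sum.inl_injective
  have hmgf := hind.mgf_sum₀ (t := -1) (fun i => (h.interarrival_law i).aemeasurable)
    (Finset.Ioc n (n + i))
  simp only [h.mgf_interarrival, Finset.prod_const, Nat.card_Ioc, Nat.add_sub_cancel_left] at hmgf
  have hfun : (∑ l ∈ Finset.Ioc n (n + i), T l) = fun ω => ∑ l ∈ Finset.Ioc n (n + i), T l ω := by
    ext ω; simp
  rw [hfun] at hmgf
  have := measure_le_le_exp_mul_mgf (μ := P) (t := -1)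
    (X := fun ω => ∑ l ∈ Finset.Ioc n (n + i), T l ω) S (by norm_num) (by
      refine Integrable.of_bound (C := 1) ?_ ?_
      · exact (Real.measurable_exp.comp_aemeasurable ((Finset.aemeasurable_fun_sum _ fun l _ =>
          (h.interarrival_law l).aemeasurable).const_mul _)).aestronglyMeasurable
      · filter_upwards [h.ae_interarrival_nonneg] with ω ht
        rw [Real.norm_of_nonneg (Real.exp_pos _).le, Real.exp_le_one_iff]
        have := Finset.sum_nonneg (s := Finset.Ioc n (n + i)) fun l _ => ht l
        linarith)
  rw [hmgf] at this
  simpa using this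

/-- Below the critical load the backlog converges in distribution. -/
lemma convergesInDistribution_backlog [NeZero m] (h : QueueInput lam ν T G P)
    (hstab : ∫ x, x ∂ν < m / lam) :
    ConvergesInDistribution
      (fun n ω => queueBacklog m (fun i => T i ω) (fun i => G i ω) n 0) P := by
  refine convergesInDistribution_of_monotone
    (fun n => identDistrib_comp_rev h.interarrival_law h.service_law h.indep n
      (F := fun t g => queueBacklog m t g n 0) (measurable_queueBacklog_coord n 0))
    (fun ω => ?_) fun ε hε => ?_
  · refine monotone_nat_of_le_succ fun n => queueBacklog_le_succ n 0 (fun i _ hi => ?_)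
      (fun i hi => ?_)
    · rw [rev_succ_succ hi]
    · rw [rev_succ_succ hi.le]
  · obtain ⟨C, hC⟩ := h.exists_integral_sum_workload_le hstab
    set D := |C| + 1 with hD
    have hDpos : 0 < D := by positivity
    -- the work seen by a job exceeds `S` with probability at most `ε / 2`
    set S := D / (ε / 2) with hS
    have hSpos : 0 < S := by positivity
    have hl := h.rate_pos
    have hr : lam / (lam + 1) < 1 := by rw [div_lt_one (by linarith)]; linarith
    have hlim : Tendsto (fun i : ℕ => Real.exp S * (lam / (lam + 1)) ^ i) atTop (𝓝 0) := by
      simpa using (tendsto_pow_atTop_nhds_zero_of_lt_one (by positivity) hr).const_mul (Real.exp S)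
    obtain ⟨i, hi⟩ := (hlim.eventually_lt_const (half_pos hε)).exists
    refine ⟨i, fun n => ?_⟩
    rcases lt_or_ge n i with hn | hn
    · have : {ω | i < queueBacklog m (fun i => T i ω) (fun i => G i ω) n 0} = ∅ := by
        refine Set.eq_empty_of_forall_notMem fun ω hω => ?_
        have h1 : queueBacklog m (fun i => T i ω) (fun i => G i ω) n 0 ≤ n :=
          (Finset.card_filter_le _ _).trans (by simp)
        have h2 : i < queueBacklog m (fun i => T i ω) (fun i => G i ω) n 0 := hω
        omega
      rw [this]
      simpa using hε.le
    · obtain ⟨n, rfl⟩ := Nat.exists_eq_add_of_le' hn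
      have h1 := measureReal_lt_le_div (ae_sum_workload_nonneg (P := P) (T := T) (G := G) n)
        ((h.memLp_sum_workload (m := m) n).integrable (by norm_num))
        ((hC n).trans ((le_abs_self C).trans (by linarith : |C| ≤ D))) hSpos
      rw [hS, div_div_cancel₀ hDpos.ne', ← hS] at h1
      have h2 := h.measureReal_sum_interarrival_le n i S
      have hae : {ω | i < queueBacklog m (fun i => T i ω) (fun i => G i ω) (n + i) 0} ≤ᵐ[P]
          ({ω | S < ∑ j, workload m (fun i => T i ω) (fun i => G i ω) n j} ∪
            {ω | ∑ l ∈ Finset.Ioc n (n + i), T l ω ≤ S} : Set Ω) := by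
        filter_upwards [h.ae_service_nonneg] with ω hg hω
        by_contra hnot
        have hnot' : ¬ (S < ∑ j, workload m (fun i => T i ω) (fun i => G i ω) n j ∨
          ∑ l ∈ Finset.Ioc n (n + i), T l ω ≤ S) := hnot
        rw [not_or, not_lt, not_le] at hnot'
        have h3 := queueBacklog_le (m := m) (t := fun i => T i ω) (g := fun i => G i ω) hg n i
          (hnot'.1.trans hnot'.2.le)
        exact absurd h3 (not_le.2 hω)
      calc _ ≤ P.real ({ω | S < ∑ j, workload m (fun i => T i ω) (fun i => G i ω) n j} ∪
            {ω | ∑ l ∈ Finset.Ioc n (n + i), T l ω ≤ S} : Set Ω) :=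
            ENNReal.toReal_mono (measure_ne_top _ _) (measure_mono_ae hae)
        _ ≤ _ := measureReal_union_le _ _
        _ ≤ ε / 2 + ε / 2 := add_le_add h1 (h2.trans hi.le)
        _ = ε := add_halves ε

end QueueInput

namespace QueueInput

variable {Ω : Type*} [MeasurableSpace Ω] {P : Measure Ω} {lam : ℝ}
  {ν : Measure ℝ} {T G : ℕ → Ω → ℝ} {m : ℕ}

/-! ### Instability at and above the critical load -/

lemma iIndepFun_increment (h : QueueInput lam ν T G P) (m : ℕ) :
    iIndepFun (fun i ω => G i ω - m * T (i + 1) ω) P := by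
  let e : (_ : ℕ) × Bool → ℕ ⊕ ℕ := fun p => if p.2 then .inr p.1 else .inl (p.1 + 1)
  have he : Function.Injective e := by
    rintro ⟨i, a⟩ ⟨j, b⟩ hab
    cases a <;> cases b <;> simp [e] at hab <;> simp [hab]
  have hcurry := iIndepFun_curry (P := P) (κ := fun _ : ℕ => Bool)
    (X := fun i b => Sum.elim T G (e ⟨i, b⟩))
    (fun i b => aemeasurable_pi_iff.1 h.aemeasurable_input _) (h.indep.precomp he)
  exact hcurry.comp (fun _ x => x true - m * x false) fun _ =>
    (measurable_pi_apply true).sub ((measurable_pi_apply false).const_mul _)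

lemma memLp_increment (h : QueueInput lam ν T G P) (m i : ℕ) :
    MemLp (fun ω => G i ω - m * T (i + 1) ω) 2 P :=
  (h.memLp_service i).sub ((h.memLp_interarrival (i + 1)).const_mul _)

lemma indepFun_service_interarrival (h : QueueInput lam ν T G P) (i j : ℕ) :
    IndepFun (G i) (T j) P :=
  h.indep.indepFun (i := .inr i) (j := .inl j) (by simp)

variable [IsProbabilityMeasure P]

lemma identDistrib_increment (h : QueueInput lam ν T G P) (m i j : ℕ) :
    IdentDistrib (fun ω => G i ω - m * T (i + 1) ω) (fun ω => G j ω - m * T (j + 1) ω) P P := by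
  have hG : IdentDistrib (G i) (G j) P P := ⟨(h.service_law i).aemeasurable,
    (h.service_law j).aemeasurable, (h.service_law i).map_eq.trans (h.service_law j).map_eq.symm⟩
  have hT : IdentDistrib (T (i + 1)) (T (j + 1)) P P := ⟨(h.interarrival_law _).aemeasurable,
    (h.interarrival_law _).aemeasurable,
    (h.interarrival_law _).map_eq.trans (h.interarrival_law _).map_eq.symm⟩
  have hp := hG.prodMk hT (h.indepFun_service_interarrival i (i + 1))
    (h.indepFun_service_interarrival j (j + 1))
  exact hp.comp (u := fun p : ℝ × ℝ => p.1 - m * p.2) (by fun_prop)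

lemma variance_increment_ne_zero [NeZero m] (h : QueueInput lam ν T G P) :
    Var[fun ω => G 0 ω - m * T 1 ω; P] ≠ 0 := by
  have hm : (0 : ℝ) < m := Nat.cast_pos.2 (NeZero.pos m)
  have hl := h.rate_pos
  have hT := (h.memLp_interarrival 1).const_mul (-(m : ℝ))
  have hind : IndepFun (G 0) (fun ω => -(m : ℝ) * T 1 ω) P :=
    (h.indepFun_service_interarrival 0 1).comp measurable_id (measurable_id.const_mul (-(m : ℝ)))
  have e : (fun ω => G 0 ω - m * T 1 ω) = G 0 + fun ω => -(m : ℝ) * T 1 ω := by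
    ext ω; simp; ring
  have hvar : Var[T 1; P] = 1 / lam ^ 2 := by
    have := variance_eq_sub (h.memLp_interarrival 1)
    have h2 := h.integral_sq_interarrival 1
    have h1 := h.integral_interarrival 1
    simp only [Pi.pow_apply] at this
    rw [this, h1, h2]
    field_simp
    norm_num
  rw [e, hind.variance_add (h.memLp_service 0) hT, variance_const_mul, hvar]
  have h1 := variance_nonneg (G 0) P
  have h2 : 0 < (-(m : ℝ)) ^ 2 * (1 / lam ^ 2) := by rw [neg_sq]; positivity
  exact (add_pos_of_nonneg_of_pos h1 h2).ne'

/-- By the central limit theorem, the work brought by the first `n` jobs exceeds the full capacity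
of the servers by at least `√n` with a probability that stays away from zero. -/
lemma exists_measureReal_sum_increment_ge [NeZero m] (h : QueueInput lam ν T G P)
    (hunst : m / lam ≤ ∫ x, x ∂ν) :
    ∃ p : ℝ, 0 < p ∧ ∀ᶠ n : ℕ in atTop,
      p < P.real {ω | √n ≤ ∑ i ∈ Finset.range n, (G i ω - m * T (i + 1) ω)} := by
  set U : ℕ → Ω → ℝ := fun i ω => G i ω - m * T (i + 1) ω with hU
  set v := Var[U 0; P].toNNReal with hv
  have hv0 : v ≠ 0 := by
    have h1 : Var[U 0; P] ≠ 0 := h.variance_increment_ne_zero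
    have h2 := variance_nonneg (U 0) P
    exact (Real.toNNReal_pos.2 (lt_of_le_of_ne h2 h1.symm)).ne'
  have hmean : 0 ≤ P[U 0] := by
    have h1 : P[U 0] = ∫ x, x ∂ν - m * (1 / lam) := by
      rw [hU, integral_sub ((h.memLp_service 0).integrable (by norm_num))
        (((h.memLp_interarrival _).integrable (by norm_num)).const_mul _), integral_const_mul,
        h.integral_service, h.integral_interarrival]
    rw [h1, mul_one_div]
    linarith
  have hclt := tendstoInDistribution_inv_sqrt_mul_sum_sub (P := P) (X := U) (Y := id)
    (P' := gaussianReal 0 v) ⟨aemeasurable_id, Measure.map_id⟩ (h.memLp_increment m 0)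
    (h.iIndepFun_increment m) (fun i => h.identDistrib_increment m i 0)
  have hpos : 0 < gaussianReal 0 v (Set.Ioi 1) := by
    refine pos_iff_ne_zero.2 fun h0 => ?_
    have := gaussianReal_absolutelyContinuous' 0 hv0 h0
    simp at this
  have hlim := ProbabilityMeasure.le_liminf_measure_open_of_tendsto hclt.tendsto
    (isOpen_Ioi (a := (1 : ℝ)))
  obtain ⟨p, hp0, hp⟩ := ENNReal.lt_iff_exists_real_btwn.1 hpos
  have hp0' : 0 < p := ENNReal.ofReal_pos.1 hp.1
  refine ⟨p, hp0', ?_⟩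
  have hev := eventually_lt_of_lt_liminf (lt_of_lt_of_le hp.2 (by
    simpa using hlim))
  filter_upwards [hev, eventually_gt_atTop 0] with n hn hn0
  rw [Measure.map_apply_of_aemeasurable (hclt.forall_aemeasurable n) measurableSet_Ioi] at hn
  rw [measureReal_def, ← ENNReal.ofReal_lt_iff_lt_toReal hp0'.le (measure_ne_top _ _)]
  refine hn.trans_le (measure_mono fun ω hω => ?_)
  have hω' : 1 < (√n)⁻¹ * (∑ i ∈ Finset.range n, U i ω - n * P[U 0]) := hω
  have hs : 0 < √(n : ℝ) := Real.sqrt_pos.2 (Nat.cast_pos.2 hn0)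
  rw [inv_mul_eq_div, lt_div_iff₀ hs] at hω'
  have : 0 ≤ (n : ℝ) * P[U 0] := mul_nonneg n.cast_nonneg hmean
  change √n ≤ ∑ i ∈ Finset.range n, U i ω
  linarith

/-- Square integrability makes the largest of the first `n` service times `o(√n)` in
probability. -/
lemma tendsto_measureReal_exists_service_gt (h : QueueInput lam ν T G P) {c : ℝ} (hc : 0 < c) :
    Tendsto (fun n : ℕ => P.real {ω | ∃ i < n, c * √n < G i ω}) atTop (𝓝 0) := by
  have hsq : Integrable (fun x : ℝ => x ^ 2) ν := h.service_memLp.integrable_sq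
  have hprob : IsProbabilityMeasure ν := (h.service_law 0).isProbabilityMeasure_iff.1 inferInstance
  have hanti : Antitone fun n : ℕ => Set.Ioi (c * √(n : ℝ)) := fun a b hab =>
    Set.Ioi_subset_Ioi (mul_le_mul_of_nonneg_left (Real.sqrt_le_sqrt (Nat.cast_le.2 hab)) hc.le)
  have hint : ⋂ n : ℕ, Set.Ioi (c * √(n : ℝ)) = ∅ := by
    refine Set.eq_empty_of_forall_notMem fun x hx => ?_
    have hlim : Tendsto (fun n : ℕ => c * √(n : ℝ)) atTop atTop :=
      (Real.tendsto_sqrt_atTop.comp tendsto_natCast_atTop_atTop).const_mul_atTop hc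
    obtain ⟨n, hn⟩ := (hlim.eventually_ge_atTop x).exists
    exact absurd (Set.mem_iInter.1 hx n) (not_lt.2 hn)
  have htail : Tendsto (fun n : ℕ => ∫ x in Set.Ioi (c * √(n : ℝ)), x ^ 2 ∂ν) atTop (𝓝 0) := by
    have := tendsto_setIntegral_of_antitone (μ := ν) (f := fun x : ℝ => x ^ 2)
      (s := fun n : ℕ => Set.Ioi (c * √(n : ℝ))) (fun _ => measurableSet_Ioi) hanti
      ⟨0, hsq.integrableOn⟩
    rwa [hint, setIntegral_empty] at this
  have hbound : ∀ n : ℕ, P.real {ω | ∃ i < n, c * √n < G i ω} ≤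
      (c ^ 2)⁻¹ * ∫ x in Set.Ioi (c * √(n : ℝ)), x ^ 2 ∂ν := by
    intro n
    have h1 : P.real {ω | ∃ i < n, c * √n < G i ω} ≤ n * ν.real (Set.Ioi (c * √(n : ℝ))) := by
      have e : {ω | ∃ i < n, c * √n < G i ω} =
          ⋃ i ∈ Finset.range n, {ω | c * √n < G i ω} := by ext; simp
      rw [e]
      refine (measureReal_biUnion_finset_le _ _).trans ?_
      have : ∀ i ∈ Finset.range n, P.real {ω | c * √n < G i ω} = ν.real (Set.Ioi (c * √(n : ℝ))) :=
        fun i _ => (h.service_law i).measureReal_eq (p := fun x => c * √n < x) measurableSet_Ioi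
      rw [Finset.sum_congr rfl this]
      simp
    have h2 : c ^ 2 * (n * ν.real (Set.Ioi (c * √(n : ℝ)))) ≤
        ∫ x in Set.Ioi (c * √(n : ℝ)), x ^ 2 ∂ν := by
      have h3 : ∫ _x in Set.Ioi (c * √(n : ℝ)), (c * √n) ^ 2 ∂ν ≤
          ∫ x in Set.Ioi (c * √(n : ℝ)), x ^ 2 ∂ν := by
        refine setIntegral_mono_on (integrableOn_const (measure_ne_top _ _)) hsq.integrableOn
          measurableSet_Ioi fun x hx => ?_
        exact pow_le_pow_left₀ (by positivity) (le_of_lt hx) 2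
      rw [setIntegral_const, mul_pow, Real.sq_sqrt n.cast_nonneg, smul_eq_mul] at h3
      linarith
    rw [← div_eq_inv_mul, le_div_iff₀' (by positivity)]
    exact (mul_le_mul_of_nonneg_left h1 (by positivity)).trans h2
  refine squeeze_zero (fun n => measureReal_nonneg) hbound ?_
  simpa using htail.const_mul (c ^ 2)⁻¹

/-- At and above the critical load, with probability bounded away from zero the work present is
at least `√n` while no service time so far exceeds `c √n`. -/
lemma exists_measureReal_workload_large [NeZero m] (h : QueueInput lam ν T G P)
    (hunst : m / lam ≤ ∫ x, x ∂ν) :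
    ∃ p : ℝ, 0 < p ∧ ∀ c : ℝ, 0 < c → ∀ᶠ n : ℕ in atTop,
      p ≤ P.real {ω | √n ≤ ∑ j, workload m (fun i => T i ω) (fun i => G i ω) n j ∧
        ∀ i < n, G i ω ≤ c * √n} := by
  obtain ⟨p, hp, hev⟩ := h.exists_measureReal_sum_increment_ge hunst
  refine ⟨p / 2, half_pos hp, fun c hc => ?_⟩
  have hmax := (h.tendsto_measureReal_exists_service_gt hc).eventually_lt_const (half_pos hp)
  filter_upwards [hev, hmax] with n h1 h2
  have hsub : {ω | √n ≤ ∑ i ∈ Finset.range n, (G i ω - m * T (i + 1) ω)} ⊆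
      {ω | √n ≤ ∑ j, workload m (fun i => T i ω) (fun i => G i ω) n j ∧
        ∀ i < n, G i ω ≤ c * √n} ∪ {ω | ∃ i < n, c * √n < G i ω} := by
    intro ω hω
    by_cases hex : ∃ i < n, c * √n < G i ω
    · exact Or.inr hex
    · refine Or.inl ⟨le_trans hω
        (le_sum_workload (fun i => T i ω) (fun i => G i ω) n), ?_⟩
      intro i hi
      by_contra! hlt
      exact hex ⟨i, hi, hlt⟩
  have h3 := (measureReal_mono (μ := P) hsub).trans (measureReal_union_le _ _)
  linarith

/-- At and above the critical load the delay is not bounded in probability. -/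
lemma not_convergesInDistribution_delay [NeZero m] (h : QueueInput lam ν T G P)
    (hunst : m / lam ≤ ∫ x, x ∂ν) :
    ¬ ConvergesInDistribution
      (fun n ω => waiting m (fun i => T i ω) (fun i => G i ω) n + G n ω) P := by
  intro hconv
  obtain ⟨p, hp, hlarge⟩ := h.exists_measureReal_workload_large hunst
  obtain ⟨K, hK⟩ := hconv.exists_eventually_lt hp
  have hm : (0 : ℝ) < m := Nat.cast_pos.2 (NeZero.pos m)
  have hsqrt : Tendsto (fun n : ℕ => √(n : ℝ) / (2 * m)) atTop atTop :=
    (Real.tendsto_sqrt_atTop.comp tendsto_natCast_atTop_atTop).atTop_div_const (by positivity)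
  obtain ⟨n, h1, h2, h3⟩ := ((hlarge (1 / (2 * m)) (by positivity)).and
    (hK.and (hsqrt.eventually_gt_atTop (K : ℝ)))).exists
  refine absurd h1 (not_le.2 (lt_of_le_of_lt (ENNReal.toReal_mono (measure_ne_top _ _)
    (measure_mono_ae ?_)) h2))
  filter_upwards [h.ae_service_nonneg] with ω hg hω
  obtain ⟨hQ, hmax⟩ : √n ≤ ∑ j, workload m (fun i => T i ω) (fun i => G i ω) n j ∧
    ∀ i < n, G i ω ≤ 1 / (2 * m) * √n := hω
  change (K : ℝ) < waiting m (fun i => T i ω) (fun i => G i ω) n + G n ω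
  -- the loads of all servers are within `√n / (2 m)` of the least one
  have hspread : ∀ j, workload m (fun i => T i ω) (fun i => G i ω) n j ≤
      waiting m (fun i => T i ω) (fun i => G i ω) n + 1 / (2 * m) * √n := by
    intro j
    obtain ⟨l, hl⟩ := exists_eq_ciInf_of_finite
      (f := workload m (fun i => T i ω) (fun i => G i ω) n)
    rw [waiting, ← hl]
    exact workload_le_add (by positivity) hg n hmax j l
  have hsum := Finset.sum_le_sum fun j (_ : j ∈ Finset.univ) => hspread j
  rw [Finset.sum_const, Finset.card_univ, Fintype.card_fin, nsmul_eq_mul, mul_add] at hsum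
  have e : (m : ℝ) * (1 / (2 * m) * √n) = √n / 2 := by field_simp
  have e2 : √(n : ℝ) / (2 * m) * m = √n / 2 := by field_simp
  have h4 : √(n : ℝ) / (2 * m) ≤ waiting m (fun i => T i ω) (fun i => G i ω) n := by
    rw [← mul_le_mul_iff_left₀ hm, e2, mul_comm _ (m : ℝ)]
    linarith
  linarith [hg n]

/-- At and above the critical load the backlog is not bounded in probability. -/
lemma not_convergesInDistribution_backlog [NeZero m] (h : QueueInput lam ν T G P)
    (hunst : m / lam ≤ ∫ x, x ∂ν) :
    ¬ ConvergesInDistribution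
      (fun n ω => queueBacklog m (fun i => T i ω) (fun i => G i ω) n 0) P := by
  rintro ⟨ν', hν'⟩
  have hcast := hν'.continuous_comp (g := fun i : ℕ => (i : ℝ)) continuous_of_discreteTopology
  have hae : AEMeasurable (fun i : ℕ => (i : ℝ)) (ν' : Measure ℕ) :=
    (measurable_of_countable _).aemeasurable
  have hconv : ConvergesInDistribution
      (fun n ω => (queueBacklog m (fun i => T i ω) (fun i => G i ω) n 0 : ℝ)) P := by
    let ν₁ : ProbabilityMeasure ℝ :=
      ⟨(ν' : Measure ℕ).map fun i : ℕ => (i : ℝ), Measure.isProbabilityMeasure_map hae⟩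
    refine ⟨ν₁, hcast.forall_aemeasurable, aemeasurable_id, ?_⟩
    have e : (⟨(ν₁ : Measure ℝ).map id, Measure.isProbabilityMeasure_map aemeasurable_id⟩ :
        ProbabilityMeasure ℝ) = ν₁ := Subtype.ext Measure.map_id
    rw [e]
    exact hcast.tendsto
  obtain ⟨p, hp, hlarge⟩ := h.exists_measureReal_workload_large hunst
  obtain ⟨K, hK⟩ := hconv.exists_eventually_lt hp
  obtain ⟨n, h1, h2, h3⟩ := ((hlarge (1 / (2 * (K + 1))) (by positivity)).and
    (hK.and (eventually_gt_atTop 0))).exists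
  refine absurd h1 (not_le.2 (lt_of_le_of_lt (ENNReal.toReal_mono (measure_ne_top _ _)
    (measure_mono_ae ?_)) h2))
  filter_upwards [h.ae_interarrival_nonneg, h.ae_service_nonneg] with ω ht hg hω
  obtain ⟨hQ, hmax⟩ : √n ≤ ∑ j, workload m (fun i => T i ω) (fun i => G i ω) n j ∧
    ∀ i < n, G i ω ≤ 1 / (2 * (K + 1)) * √n := hω
  change (K : ℝ) < queueBacklog m (fun i => T i ω) (fun i => G i ω) n 0
  by_contra! hle
  -- at most `K` jobs are present and each brings at most `√n / (2 (K + 1))`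
  have hs : 0 < √(n : ℝ) := Real.sqrt_pos.2 (Nat.cast_pos.2 h3)
  have h4 := hQ.trans (sum_workload_le_queueBacklog (m := m) ht hg n hmax)
  have h5 : (queueBacklog m (fun i => T i ω) (fun i => G i ω) n 0 : ℝ) *
      (1 / (2 * (K + 1)) * √n) ≤ (K + 1) * (1 / (2 * (K + 1)) * √n) :=
    mul_le_mul_of_nonneg_right (by linarith) (by positivity)
  have e : ((K : ℝ) + 1) * (1 / (2 * (K + 1)) * √n) = √n / 2 := by field_simp
  linarith

/-- A queue with `m` servers is stable if and only if its load is below the number of servers. -/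
lemma convergesInDistribution_delay_iff [NeZero m] (h : QueueInput lam ν T G P) :
    ConvergesInDistribution
      (fun n ω => waiting m (fun i => T i ω) (fun i => G i ω) n + G n ω) P ↔
      ∫ x, x ∂ν < m / lam :=
  ⟨fun hc => not_le.1 fun hle => h.not_convergesInDistribution_delay hle hc,
    h.convergesInDistribution_delay⟩

lemma convergesInDistribution_backlog_iff [NeZero m] (h : QueueInput lam ν T G P) :
    ConvergesInDistribution
      (fun n ω => queueBacklog m (fun i => T i ω) (fun i => G i ω) n 0) P ↔
      ∫ x, x ∂ν < m / lam :=
  ⟨fun hc => not_le.1 fun hle => h.not_convergesInDistribution_backlog hle hc,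
    h.convergesInDistribution_backlog⟩

end QueueInput

/-! ### The barrier system -/

lemma monotone_arrival {Ω : Type*} {T : ℕ → Ω → ℝ} {ω : Ω}
    (hT : ∀ n, 0 ≤ T n ω) : Monotone (arrival T ω) :=
  monotone_nat_of_le_succ fun n => by
    rw [arrival, arrival, Finset.sum_range_succ _ (n + 1)]
    linarith [hT (n + 1)]

section

variable {Ω : Type*} [MeasurableSpace Ω] {P : Measure Ω} {lam μ : ℝ} {s k : ℕ}
  {T : ℕ → Ω → ℝ} {X : ℕ → Fin k → Ω → ℝ}

lemma IsExpInput.aemeasurable (h : IsExpInput lam μ T X P) (p : ℕ ⊕ ℕ × Fin k) :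
    AEMeasurable (Sum.elim T (fun p : ℕ × Fin k => X p.1 p.2) p) P := by
  rcases p with i | p
  · exact (h.interarrival_law i).aemeasurable
  · exact (h.task_law p.1 p.2).aemeasurable

/-- The service times of different jobs and the inter-arrival times are independent. -/
lemma IsExpInput.iIndepFun_service (h : IsExpInput lam μ T X P) :
    iIndepFun (Sum.elim T fun n ω => ⨆ i, X n i ω) P := by
  -- each inter-arrival time is a block of its own, and so are the tasks of each job
  let κ : ℕ ⊕ ℕ → Type := Sum.elim (fun _ => Unit) fun _ => Fin k
  have hκ : ∀ i, Countable (κ i) := by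
    rintro (i | i)
    · exact inferInstanceAs (Countable Unit)
    · exact inferInstanceAs (Countable (Fin k))
  let e : (i : ℕ ⊕ ℕ) → κ i → ℕ ⊕ ℕ × Fin k
    | .inl n, _ => .inl n
    | .inr n, i => .inr (n, i)
  have he : Function.Injective fun p : (i : ℕ ⊕ ℕ) × κ i => e p.1 p.2 := by
    rintro ⟨i | i, a⟩ ⟨j | j, b⟩ hab
    · have : i = j := Sum.inl_injective hab
      subst this
      rfl
    · exact absurd hab Sum.inl_ne_inr
    · exact absurd hab Sum.inr_ne_inl
    · obtain ⟨h1, h2⟩ := Prod.mk.inj (Sum.inr_injective hab)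
      subst h1
      exact congrArg (Sigma.mk (β := κ) (Sum.inr i)) h2
  have hcurry := iIndepFun_curry (P := P) (κ := κ)
    (X := fun i j => Sum.elim T (fun p : ℕ × Fin k => X p.1 p.2) (e i j))
    (fun i j => h.aemeasurable _) (h.indep.precomp he)
  let φ : (i : ℕ ⊕ ℕ) → (κ i → ℝ) → ℝ
    | .inl _, x => x ()
    | .inr _, x => ⨆ i : Fin k, x i
  have hφ : ∀ i, Measurable (φ i) := by
    rintro (i | i)
    · exact measurable_pi_apply (X := fun _ : Unit => ℝ) ()
    · exact measurable_iSup_fin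
  convert hcurry.comp φ hφ using 1
  ext i ω
  rcases i with i | i <;> rfl

lemma IsExpInput.hasLaw_service (h : IsExpInput lam μ T X P) (n : ℕ) :
    HasLaw (fun ω => ⨆ i, X n i ω) (maxExpLaw k μ) P := by
  have := h.indep.isProbabilityMeasure
  have hX : ∀ i, AEMeasurable (X n i) P := fun i => (h.task_law n i).aemeasurable
  have hind : iIndepFun (X n) P := h.indep.precomp (g := fun i : Fin k => Sum.inr (n, i))
    fun i j hij => (Prod.mk.inj (Sum.inr_injective hij)).2
  have hmap := (iIndepFun_iff_map_fun_eq_pi_map hX).1 hind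
  have hae : AEMeasurable (fun ω i => X n i ω) P := aemeasurable_pi_iff.2 hX
  refine ⟨measurable_iSup_fin.comp_aemeasurable hae, ?_⟩
  rw [maxExpLaw, ← funext fun i => (h.task_law n i).map_eq, ← hmap,
    AEMeasurable.map_map_of_aemeasurable measurable_iSup_fin.aemeasurable hae]
  rfl

lemma ae_nonneg_maxExpLaw {k : ℕ} (hk : 0 < k) {μ : ℝ} (hμ : 0 < μ) :
    ∀ᵐ x ∂(maxExpLaw k μ), 0 ≤ x := by
  have := isProbabilityMeasure_maxExpLaw (k := k) hμ
  have : Nonempty (Fin k) := ⟨⟨0, hk⟩⟩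
  rw [maxExpLaw, ae_map_iff measurable_iSup_fin.aemeasurable measurableSet_Ici]
  have hp := isProbabilityMeasure_expMeasure hμ
  filter_upwards [(measurePreserving_eval (fun _ : Fin k => expMeasure μ)
    ⟨0, hk⟩).quasiMeasurePreserving.ae (ae_nonneg_expMeasure μ)] with x hx
  exact hx.trans (le_ciSup (Set.finite_range x).bddAbove _)

lemma IsExpInput.queueInput (h : IsExpInput lam μ T X P) (hk : 0 < k) (hlam : 0 < lam)
    (hμ : 0 < μ) : QueueInput lam (maxExpLaw k μ) T (fun n ω => ⨆ i, X n i ω) P where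
  rate_pos := hlam
  interarrival_law := h.interarrival_law
  service_law := h.hasLaw_service
  indep := h.iIndepFun_service
  service_nonneg := ae_nonneg_maxExpLaw hk hμ
  service_memLp := memLp_maxExpLaw hμ hk

variable {m : ℕ} [NeZero m]

lemma IsExpInput.isMGQueue (h : IsExpInput lam μ T X P) (hk : 0 < k) (hs : s = k * m)
    (hlam : 0 < lam) (hμ : 0 < μ) :
    IsMGQueue lam (maxExpLaw k μ) m T (fun n ω => ⨆ i, X n i ω)
      (startTime s T X) (departureTime s T X) P where
  interarrival_law := h.interarrival_law
  service_law := h.hasLaw_service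
  indep := h.iIndepFun_service
  start_eq := by
    have hq := h.queueInput hk hlam hμ
    filter_upwards [hq.ae_interarrival_nonneg, hq.ae_service_nonneg] with ω hT hG n
    exact start_eq_queueStart hk hs (monotone_arrival hT) hG n
  departure_eq := by
    have hq := h.queueInput hk hlam hμ
    filter_upwards [hq.ae_interarrival_nonneg, hq.ae_service_nonneg] with ω hT hG n
    exact departure_eq_queueDeparture hk hs (monotone_arrival hT) hG n

lemma IsExpInput.delay_ae_eq (h : IsExpInput lam μ T X P) (hk : 0 < k) (hs : s = k * m)
    (hlam : 0 < lam) (hμ : 0 < μ) (n : ℕ) :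
    delay s T X n =ᵐ[P] fun ω =>
      waiting m (fun i => T i ω) (fun i => ⨆ j, X i j ω) n + ⨆ j, X n j ω := by
  filter_upwards [(h.queueInput hk hlam hμ).ae_interarrival_nonneg,
    (h.isMGQueue hk hs hlam hμ).departure_eq] with ω hT hD
  have hstart := queueStart_eq (m := m) (t := fun i => T i ω) (g := fun i => ⨆ j, X i j ω) hT n
  rw [delay, hD n]
  change queueStart m (fun n => ∑ i ∈ Finset.range (n + 1), T i ω) _ n + (⨆ j, X n j ω)
    - ∑ i ∈ Finset.range (n + 1), T i ω = _
  rw [hstart]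
  ring

lemma IsExpInput.backlog_ae_eq (h : IsExpInput lam μ T X P) (hk : 0 < k) (hs : s = k * m)
    (hlam : 0 < lam) (hμ : 0 < μ) (n : ℕ) :
    backlog s T X n =ᵐ[P] fun ω =>
      queueBacklog m (fun i => T i ω) (fun i => ⨆ j, X i j ω) n 0 := by
  filter_upwards [(h.queueInput hk hlam hμ).ae_interarrival_nonneg,
    (h.isMGQueue hk hs hlam hμ).departure_eq] with ω hT hD
  rw [← card_not_departed_eq_queueBacklog hT n, backlog]
  simp_rw [hD]
  rfl

variable [IsProbabilityMeasure P]

lemma IsExpInput.delayStable_iff (h : IsExpInput lam μ T X P) (hk : 0 < k) (hs : s = k * m)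
    (hlam : 0 < lam) (hμ : 0 < μ) :
    DelayStable s T X P ↔ (harmonic k : ℝ) / μ < m / lam := by
  rw [← integral_maxExpLaw hμ hk, ← (h.queueInput hk hlam hμ).convergesInDistribution_delay_iff]
  exact convergesInDistribution_congr fun n => h.delay_ae_eq hk hs hlam hμ n

lemma IsExpInput.backlogStable_iff (h : IsExpInput lam μ T X P) (hk : 0 < k) (hs : s = k * m)
    (hlam : 0 < lam) (hμ : 0 < μ) :
    BacklogStable s T X P ↔ (harmonic k : ℝ) / μ < m / lam := by
  rw [← integral_maxExpLaw hμ hk, ← (h.queueInput hk hlam hμ).convergesInDistribution_backlog_iff]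
  exact convergesInDistribution_congr fun n => h.backlog_ae_eq hk hs hlam hμ n

end

lemma harmonic_eq_sum_range_sub (k : ℕ) :
    (harmonic k : ℝ) = ∑ j ∈ Finset.range k, 1 / ((k : ℝ) - (j : ℝ)) := by
  rw [harmonic, ← Finset.sum_range_reflect]
  push_cast
  refine Finset.sum_congr rfl fun j hj => ?_
  have hj' : j + 1 ≤ k := Finset.mem_range.1 hj
  rw [show k - 1 - j = k - (j + 1) by omega, Nat.cast_sub hj', one_div]
  push_cast
  ring

end BEM

theorem mainTheorem4 {Ω : Type*} [MeasurableSpace Ω] (P : Measure Ω) [IsProbabilityMeasure P]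
    (s k : ℕ) (hs : 0 < s) (hks : k ∣ s) (lam μ : ℝ) (hlam : 0 < lam) (hμ : 0 < μ)
    (T : ℕ → Ω → ℝ) (X : ℕ → Fin k → Ω → ℝ) (hTX : BEM.IsExpInput lam μ T X P) :
    -- the system is an M|G|(s/k) queue whose service time is the maximum of the task times
    BEM.IsMGQueue lam (BEM.maxExpLaw k μ) (s / k) T (fun n ω => ⨆ i, X n i ω)
      (BEM.startTime s T X) (BEM.departureTime s T X) P ∧
    -- the maximum is distributed as a sum of independent exponentials with rates μ, 2μ, …, kμ
    BEM.maxExpLaw k μ =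
      (Measure.pi fun j : Fin k => expMeasure (((j : ℕ) + 1 : ℝ) * μ)).map
        (fun y => ∑ j, y j) ∧
    -- its mean
    (Integrable (fun x : ℝ => x) (BEM.maxExpLaw k μ) ∧
      ∫ x, x ∂(BEM.maxExpLaw k μ) = (harmonic k : ℝ) / μ) ∧
    -- stability in terms of the arrival rate
    ((BEM.DelayStable s T X P ↔ lam < (s : ℝ) / k * (μ / (harmonic k : ℝ))) ∧
      (BEM.BacklogStable s T X P ↔ lam < (s : ℝ) / k * (μ / (harmonic k : ℝ)))) ∧
    -- stability in terms of the utilization; the bound does not involve s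
    ((BEM.DelayStable s T X P ↔ BEM.utilization s k lam μ < 1 / (harmonic k : ℝ)) ∧
      (BEM.BacklogStable s T X P ↔ BEM.utilization s k lam μ < 1 / (harmonic k : ℝ))) ∧
    (1 / (harmonic k : ℝ) = 1 / ∑ j ∈ Finset.range k, 1 / ((k : ℝ) - (j : ℝ))) := by
  have hk : 0 < k := Nat.pos_of_dvd_of_pos hks hs
  obtain ⟨m, rfl⟩ := hks
  have hm : 0 < m := Nat.pos_of_mul_pos_left hs
  have : NeZero m := ⟨hm.ne'⟩
  rw [Nat.mul_div_cancel_left m hk]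
  have hH : (0 : ℝ) < harmonic k := by exact_mod_cast harmonic_pos hk.ne'
  have hk' : (0 : ℝ) < k := Nat.cast_pos.2 hk
  have hm' : (0 : ℝ) < m := Nat.cast_pos.2 hm
  have hrate : (harmonic k : ℝ) / μ < m / lam ↔
      lam < ((k * m : ℕ) : ℝ) / k * (μ / (harmonic k : ℝ)) := by
    push_cast
    rw [mul_div_cancel_left₀ _ hk'.ne', ← mul_div_assoc, lt_div_iff₀ hH, div_lt_div_iff₀ hμ hlam,
      mul_comm lam]
  have hutil : (harmonic k : ℝ) / μ < m / lam ↔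
      BEM.utilization (k * m) k lam μ < 1 / (harmonic k : ℝ) := by
    rw [BEM.utilization]
    push_cast
    rw [mul_assoc, mul_div_mul_left _ _ hk'.ne', div_lt_div_iff₀ (by positivity) hH, one_mul,
      div_lt_div_iff₀ hμ hlam, mul_comm lam]
  have hdelay := hTX.delayStable_iff (m := m) hk rfl hlam hμ
  have hbacklog := hTX.backlogStable_iff (m := m) hk rfl hlam hμ
  have := BEM.isProbabilityMeasure_maxExpLaw (k := k) hμ
  exact ⟨hTX.isMGQueue (m := m) hk rfl hlam hμ, BEM.maxExpLaw_eq_sumExpLaw hμ hk,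
    ⟨(BEM.memLp_maxExpLaw hμ hk).integrable (by norm_num), BEM.integral_maxExpLaw hμ hk⟩,
    ⟨hdelay.trans hrate, hbacklog.trans hrate⟩, ⟨hdelay.trans hutil, hbacklog.trans hutil⟩,
    by rw [BEM.harmonic_eq_sum_range_sub]⟩
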